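/- Let $r\ge 2$ be an integer. For $n\ge 1$ and $p\in(0,1]$ let $X=\sum_{i=1}^{n}\binom{Y_i}{r}$, where $Y_1,\dots,Y_n$ are independent random variables with $Y_i\sim\mathrm{Bin}(n,p)$. Write $\mu=\mathbb E X$, $\sigma^2=\operatorname{Var}X$, $X_{\max}=n\binom nr$ (the value of $X$ for $p=1$), $\varphi(x)=(1+x)\log(1+x)-x$, and $M(t)=\max\{t^{1/r},\,t/n^{r-1}\}$ for $t\ge 0$. Then the following hold. 1. For every $\varepsilon>0$ there is $c=c(r,\varepsilon)>0$ such that, for all $n\ge1$ and $p\in(0,1]$ with $1\le(1+\varepsilon)\mu\le X_{\max}$, $$\mathbb P\bigl(X\ge(1+\varepsilon)\mu\bigr)\le\exp\Bigl(-c\,\min\bigl\{\mu,\;M(\mu)\log(1/p)\bigr\}\Bigr).$$ 2. There is $\alpha=\alpha(r)>0$ such that for every $\xi\in(0,1)$ there is $c=c(r,\xi)>0$ such that, for all $n\ge1$, $p\in(0,1-\xi]$ and $\varepsilon\ge n^{-\alpha}$ with $1\le(1+\varepsilon)\mu\le X_{\max}$ and $\Phi(\varepsilon)\ge1$, $$\mathbb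 P\bigl(X\ge(1+\varepsilon)\mu\bigr)\le\exp\bigl(-c\,\Phi(\varepsilon)\bigr),\qquad \Phi(\varepsilon)=\min\bigl\{\varphi(\varepsilon)\mu^2/\sigma^2,\;M(\varepsilon\mu)\log(e/p)\bigr\}.$$ 3. For every $\xi\in(0,1)$ there is $c=c(r,\xi)>0$ such that, for all $n\ge1$, $p\in(0,1-\xi]$ and real $t$ with $1\le\mu+t\le X_{\max}$: (i) if $p\ge(\log n)/n$ and $t\ge\sigma$, then $\mathbb P(X\ge\mu+t)\le\exp\bigl(-c\,\min\{t^2/\sigma^2,\;M(t)\log(e/p)\}\bigr)$; (ii) if $\mu\ge\xi$, $t>0$ and $t^2/\sigma^2\ge M(t)\log(e/p)\,(\log n)^{2r}$, then $\mathbb P(X\ge\mu+t)\le\exp\bigl(-c\,M(t)\log(e/p)\bigr)$. 4. Put $\Lambda=\mu\,(1+(np)^{r-1})$. For every $\gamma>0$ there is $c=c(r,\gamma)>0$ such that, for all $n\ge1$, $p\in(0,1]$ and $t>0$ satisfying, with $s=\log(e/p^{\gamma})$, either $np\notin(n^{-\gamma},\gamma\log n)$ or $$t^2/\mu\;\ge\;\mathbf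 1_{\{t\le\min\{\mu,n^r\}\}}\;\gamma\,\min\bigl\{t^{1/r}(\log n)^r,\;M(t)\,s\,(\log n)^{r-1}\bigr\},$$ we have $$\mathbb P(X\ge\mu+t)\le(1+n^{-1})\exp\Bigl(-c\,\min\bigl\{\varphi(t/\mu)\mu^2/\Lambda,\;M(t)\log(e/p)\bigr\}\Bigr).$$ (If $n<r$ then $X=0$ and the probability is $0$.) -/

import Mathlib

open MeasureTheory ProbabilityTheory

universe u

noncomputable section

/-- `Y₁, …, Yₙ` are independent random variables with law `Bin(n, p)`, on the probability
space `(Ω, P)`. -/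
structure IsBinomialSample {Ω : Type*} [MeasurableSpace Ω] (P : Measure Ω) (n : ℕ)
    (p : unitInterval) (Y : Fin n → Ω → ℕ) : Prop where
  isProbabilityMeasure : IsProbabilityMeasure P
  indep : iIndepFun Y P
  law : ∀ i, HasLaw (Y i) (binomial n p) P

/-- The random variable `X = ∑ᵢ (Yᵢ choose r)`. -/
def starSum {Ω : Type*} {n : ℕ} (r : ℕ) (Y : Fin n → Ω → ℕ) (ω : Ω) : ℝ :=
  ∑ i, ((Y i ω).choose r : ℝ)

/-- The largest possible value of `X`, which is its value for `p = 1`. -/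
def starSumMax (r n : ℕ) : ℝ := n * (n.choose r : ℝ)

/-- The Chernoff rate function `φ(x) = (1 + x) log (1 + x) - x`. -/
def chernoffRate (x : ℝ) : ℝ := (1 + x) * Real.log (1 + x) - x

/-- `M(t) = max {t^{1/r}, t / n^{r-1}}`. -/
def clusterSize (r n : ℕ) (t : ℝ) : ℝ := max (t ^ (1 / (r : ℝ))) (t / (n : ℝ) ^ (r - 1))

end

/-! All four assertions rest on one bound, `exists_measureReal_le_exp`, for all `r ≤ n`, `0 < p ≤ 1`
and `t > 0`: P(X ≥ μ + t) ≤ exp(-c min{`bulkRate`, `clusterRate`}). The two rates price two ways of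
deviating. Either the sample is collectively slightly too large, at the Chernoff cost φ(t/μ)μ²/Λ
with Λ = μ(1 + (np)^(r-1)) in place of the variance; or a few values are huge (one of order t^(1/r)
or, if that exceeds n, about t/n^r of them of order n), which takes about M(t) successful trials and
costs M(t) log(e/p).

For a threshold k, C(Y, r) is split into the part truncated at k and the part with Y > k, and each
part may contribute t/2. The threshold satisfies k ≥ e²np and log n ≤ (k/2) log(k/(enp)), so that
beyond k the Poisson tail of a binomial variable absorbs a union over the n indices. An exponential
moment over a window k < Y ≤ K, together with a union bound beyond K, gives the tail rate M(t)
log(K/(enp)) with K = max{k, min{t^(1/r), n}} (`measureReal_tail_le`). Away from the sparse regime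
this logarithm may be much smaller than log(e/p), but then the bulk rate is itself at most of order
M(t) (`min_rate_le_of_inv_le`).

The truncated part needs three regimes. If n(np)^(2r) ≤ 1, then k is constant and Bennett's
inequality is sharp enough. If np ≥ log n, then k is of order np, and exposing the trials one by
one, with Lipschitz constant k^(r-1), gives a variance proxy of the right order. In between, k is of
order log n and Bernstein's inequality is used with the true variance; the powers of log n lost in
its linear term are harmless, because a deviation with bulk rate above 1 is at least of the order of
a power of n.

This yields the bound with a prefactor 30. Cantelli's inequality has no prefactor and takes over
when the exponent is bounded (`le_exp_neg_mul_of_le_div`).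

The assertions then follow by comparing rates. For p ≤ 1 - ξ the variance has order Λ; up to the
mean the Chernoff rate is quadratic; beyond the mean, with np ≥ 1/2, the bulk rate is at least a
multiple of the cluster rate. -/

/-! ### Expectations under the binomial law -/

/-- The expectation of `h` under the binomial distribution `Bin(n, p)`. -/
noncomputable def binExp (p : ℝ) : ℕ → (ℕ → ℝ) → ℝ
  | 0, h => h 0
  | n + 1, h => binExp p n fun y => (1 - p) * h y + p * h (y + 1)

theorem binExp_mono {p : ℝ} (h0 : 0 ≤ p) (h1 : p ≤ 1) (n : ℕ) {g h : ℕ → ℝ}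
    (hgh : ∀ y, g y ≤ h y) : binExp p n g ≤ binExp p n h := by
  induction n generalizing g h with
  | zero => exact hgh 0
  | succ n ih =>
    refine ih fun y => ?_
    have := mul_le_mul_of_nonneg_left (hgh y) (sub_nonneg.2 h1)
    have := mul_le_mul_of_nonneg_left (hgh (y + 1)) h0
    linarith

theorem binExp_add (p : ℝ) (n : ℕ) (g h : ℕ → ℝ) :
    binExp p n (fun y => g y + h y) = binExp p n g + binExp p n h := by
  induction n generalizing g h with
  | zero => rfl
  | succ n ih =>
    simp only [binExp]
    rw [← ih]
    congr 1; ext y; ring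

theorem binExp_const_mul (p : ℝ) (n : ℕ) (c : ℝ) (h : ℕ → ℝ) :
    binExp p n (fun y => c * h y) = c * binExp p n h := by
  induction n generalizing h with
  | zero => rfl
  | succ n ih =>
    simp only [binExp]
    rw [← ih]
    congr 1; ext y; ring

theorem binExp_const (p : ℝ) (n : ℕ) (c : ℝ) : binExp p n (fun _ => c) = c := by
  induction n with
  | zero => rfl
  | succ n ih =>
    simp only [binExp]
    rw [← ih]
    congr 1; ext y; rw [ih]; ring

theorem binExp_sum {ι : Type*} (p : ℝ) (n : ℕ) (s : Finset ι) (h : ι → ℕ → ℝ) :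
    binExp p n (fun y => ∑ i ∈ s, h i y) = ∑ i ∈ s, binExp p n (h i) := by
  classical
  induction s using Finset.induction_on with
  | empty => simpa using binExp_const p n 0
  | insert i s hi ih =>
    simp only [Finset.sum_insert hi]
    rw [binExp_add, ih]

/-- The factorial moments of the binomial distribution. -/
theorem binExp_choose (p : ℝ) (n k : ℕ) :
    binExp p n (fun y => (y.choose k : ℝ)) = n.choose k * p ^ k := by
  induction n generalizing k with
  | zero => cases k <;> simp [binExp]
  | succ n ih =>
    cases k with
    | zero => simpa using binExp_const p (n + 1) 1
    | succ k =>
      have : ∀ y : ℕ, (1 - p) * (y.choose (k + 1) : ℝ) + p * ((y + 1).choose (k + 1) : ℝ)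
          = y.choose (k + 1) + p * y.choose k := by
        intro y; rw [Nat.choose_succ_succ]; push_cast; ring
      simp only [binExp, this]
      rw [binExp_add, binExp_const_mul, ih, ih, Nat.choose_succ_succ]
      push_cast; ring

theorem binExp_eq_sum (p : ℝ) (n : ℕ) (h : ℕ → ℝ) :
    binExp p n h = ∑ ij ∈ Finset.HasAntidiagonal.antidiagonal n,
      (n.choose ij.1 : ℝ) * (p ^ ij.1 * (1 - p) ^ ij.2 * h ij.1) := by
  induction n generalizing h with
  | zero => simp [binExp]
  | succ n ih =>
    rw [Finset.sum_antidiagonal_choose_succ_mul (fun i j => p ^ i * (1 - p) ^ j * h i),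
      ← Finset.sum_add_distrib]
    simp only [binExp]
    rw [ih]
    refine Finset.sum_congr rfl fun ij hij => ?_
    rw [← Nat.choose_symm_of_eq_add (Finset.HasAntidiagonal.mem_antidiagonal.1 hij).symm]
    ring

/-- Passage from the actual law to the recursion. The recursive form exposes one trial at a time,
which is what the factorial moments and the Lipschitz bound below are proved by. -/
theorem integral_binomial_eq_binExp (n : ℕ) (p : unitInterval) (h : ℕ → ℝ) :
    ∫ k, h k ∂(binomial n p) = binExp p n h := by
  rw [binExp_eq_sum, Finset.Nat.sum_antidiagonal_eq_sum_range_succ_mk, binomial_eq_sum_dirac,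
    integral_finsetSum_measure]
  · rw [Nat.range_succ_eq_Iic]
    refine Finset.sum_congr rfl fun k _ => ?_
    rw [integral_smul_measure, integral_dirac, ENNReal.toReal_ofReal binomial_nonneg, smul_eq_mul]
    ring
  · intro k _
    exact (integrable_dirac (by simp)).smul_measure ENNReal.ofReal_ne_top

/-! ### Chernoff and union bounds, mean and variance for a binomial sample -/

namespace IsBinomialSample

variable {Ω : Type u} [MeasurableSpace Ω] {P : Measure Ω} {n : ℕ} {p : unitInterval}
  {Y : Fin n → Ω → ℕ}

theorem aemeasurable_comp (hY : IsBinomialSample P n p Y) (g : ℕ → ℝ) (i : Fin n) :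
    AEMeasurable (fun ω => g (Y i ω)) P :=
  (measurable_of_countable g).comp_aemeasurable (hY.law i).aemeasurable

theorem integral_comp (hY : IsBinomialSample P n p Y) (g : ℕ → ℝ) (i : Fin n) :
    ∫ ω, g (Y i ω) ∂P = binExp p n g := by
  rw [← integral_binomial_eq_binExp]
  exact (hY.law i).integral_comp (measurable_of_countable g).aestronglyMeasurable

theorem ae_le (hY : IsBinomialSample P n p Y) : ∀ᵐ ω ∂P, ∀ i, Y i ω ≤ n :=
  ae_all_iff.2 fun i => ae_le_of_hasLaw_binomial (hY.law i)

theorem memLp_comp (hY : IsBinomialSample P n p Y) (g : ℕ → ℝ) (i : Fin n) (q : ENNReal) :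
    MemLp (fun ω => g (Y i ω)) q P := by
  have := hY.isProbabilityMeasure
  refine MemLp.of_bound (hY.aemeasurable_comp g i).aestronglyMeasurable
    (∑ k ∈ Finset.range (n + 1), ‖g k‖) ?_
  filter_upwards [hY.ae_le] with ω hω
  exact Finset.single_le_sum (f := fun k => ‖g k‖) (fun _ _ => norm_nonneg _)
    (Finset.mem_range.2 (Nat.lt_succ_of_le (hω i)))

theorem integrable_comp (hY : IsBinomialSample P n p Y) (g : ℕ → ℝ) (i : Fin n) :
    Integrable (fun ω => g (Y i ω)) P :=
  memLp_one_iff_integrable.1 (hY.memLp_comp g i 1)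

theorem iIndepFun_comp (hY : IsBinomialSample P n p Y) (g : ℕ → ℝ) :
    iIndepFun (fun i ω => g (Y i ω)) P :=
  hY.indep.comp (fun _ => g) fun _ => measurable_of_countable g

/-- Chernoff's bound for a sum of functions of the sample. -/
theorem measureReal_le_sum_le (hY : IsBinomialSample P n p Y) (g : ℕ → ℝ) {l : ℝ} (hl : 0 ≤ l)
    (x : ℝ) : P.real {ω | x ≤ ∑ i, g (Y i ω)} ≤
      Real.exp (-l * x) * binExp p n (fun y => Real.exp (l * g y)) ^ n := by
  have := hY.isProbabilityMeasure
  have hmgf := (hY.iIndepFun_comp g).mgf_sum₀ (t := l) (hY.aemeasurable_comp g) Finset.univ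
  have h1 : ∀ i, mgf (fun ω => g (Y i ω)) P l = binExp p n (fun y => Real.exp (l * g y)) :=
    fun i => hY.integral_comp (fun y => Real.exp (l * g y)) i
  simp only [h1, Finset.prod_const, Finset.card_univ, Fintype.card_fin] at hmgf
  rw [← hmgf]
  have := measure_ge_le_exp_mul_mgf (X := ∑ i, fun ω => g (Y i ω)) (μ := P) x hl ?_
  · simpa using this
  · refine integrable_exp_mul_of_le l (∑ _i : Fin n, ∑ k ∈ Finset.range (n + 1), ‖g k‖) hl
      (Finset.aemeasurable_sum _ fun i _ => hY.aemeasurable_comp g i) ?_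
    filter_upwards [hY.ae_le] with ω hω
    rw [Finset.sum_apply]
    refine Finset.sum_le_sum fun i _ => (le_abs_self _).trans ?_
    exact Finset.single_le_sum (f := fun k => ‖g k‖) (fun _ _ => norm_nonneg _)
      (Finset.mem_range.2 (Nat.lt_succ_of_le (hω i)))

/-- A union bound. -/
theorem measureReal_exists_le (hY : IsBinomialSample P n p Y) (k : ℕ) :
    P.real {ω | ∃ i, k ≤ Y i ω} ≤ n * (n.choose k * (p : ℝ) ^ k) := by
  have := hY.isProbabilityMeasure
  have h1 : {ω | ∃ i, k ≤ Y i ω} = ⋃ i ∈ (Finset.univ : Finset (Fin n)), {ω | k ≤ Y i ω} := by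
    ext; simp
  have h2 : ∀ i, P.real {ω | k ≤ Y i ω} ≤ n.choose k * (p : ℝ) ^ k := by
    intro i
    rw [← binExp_choose, ← hY.integral_comp _ i]
    refine le_trans ?_ (mul_meas_ge_le_integral_of_nonneg (μ := P)
      (Filter.Eventually.of_forall fun ω => Nat.cast_nonneg ((Y i ω).choose k))
      (hY.integrable_comp (fun y => (y.choose k : ℝ)) i) 1)
    rw [one_mul]
    refine measureReal_mono fun ω (hω : k ≤ Y i ω) => ?_
    simpa [Nat.one_le_iff_ne_zero] using (Nat.choose_pos hω).ne'
  rw [h1]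
  refine (measureReal_biUnion_finset_le _ _).trans ((Finset.sum_le_sum fun i _ => h2 i).trans ?_)
  simp

theorem integral_starSum (hY : IsBinomialSample P n p Y) (r : ℕ) :
    ∫ ω, starSum r Y ω ∂P = n * (n.choose r * (p : ℝ) ^ r) := by
  unfold starSum
  rw [integral_finsetSum _ fun i _ => hY.integrable_comp (fun y => (y.choose r : ℝ)) i]
  simp [hY.integral_comp (fun y => (y.choose r : ℝ)), binExp_choose]

theorem variance_starSum (hY : IsBinomialSample P n p Y) (r : ℕ) :
    variance (starSum r Y) P = n * (binExp p n (fun y => (y.choose r : ℝ) ^ 2)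
      - (n.choose r * (p : ℝ) ^ r) ^ 2) := by
  have := hY.isProbabilityMeasure
  have h1 : starSum r Y = ∑ i, fun ω => ((Y i ω).choose r : ℝ) := by
    ext ω; simp [starSum]
  rw [h1, IndepFun.variance_sum (fun i _ => hY.memLp_comp (fun y => (y.choose r : ℝ)) i 2)
    fun i _ j _ hij => (hY.iIndepFun_comp (fun y => (y.choose r : ℝ))).indepFun hij]
  have h2 : ∀ i, variance (fun ω => ((Y i ω).choose r : ℝ)) P =
      binExp p n (fun y => (y.choose r : ℝ) ^ 2) - (n.choose r * (p : ℝ) ^ r) ^ 2 := by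
    intro i
    rw [variance_eq_sub (hY.memLp_comp (fun y => (y.choose r : ℝ)) i 2),
      hY.integral_comp (fun y => (y.choose r : ℝ)) i, binExp_choose,
      ← hY.integral_comp (fun y => (y.choose r : ℝ) ^ 2) i]
    rfl
  simp only [h2, Finset.sum_const, Finset.card_univ, Fintype.card_fin, nsmul_eq_mul]

theorem memLp_starSum (hY : IsBinomialSample P n p Y) (r : ℕ) : MemLp (starSum r Y) 2 P :=
  memLp_finsetSum _ fun i _ => hY.memLp_comp (fun y => (y.choose r : ℝ)) i 2

end IsBinomialSample

/-- Cantelli's inequality. -/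
theorem measureReal_add_le_le_variance_div {Ω : Type*} [MeasurableSpace Ω] {P : Measure Ω}
    [IsProbabilityMeasure P] {X : Ω → ℝ} (hX : MemLp X 2 P) {t : ℝ} (ht : 0 < t) :
    P.real {ω | (∫ ω, X ω ∂P) + t ≤ X ω} ≤ variance X P / (variance X P + t ^ 2) := by
  set m := ∫ ω, X ω ∂P
  set v := variance X P
  have hv : 0 ≤ v := variance_nonneg X P
  -- This shift minimises (v + u²)/(t + u)², the bound that Markov's inequality gives for (X - m +
  -- u)².
  set u := v / t
  have hu : 0 ≤ u := by positivity
  have hm : MemLp (fun ω => X ω - m) 2 P := hX.sub (memLp_const m)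
  have hi : Integrable (fun ω => (X ω - m) ^ 2) P := hm.integrable_sq
  have hi1 : Integrable (fun ω => X ω - m) P := hm.integrable (by norm_num)
  have e1 : ∀ ω, (X ω - m + u) ^ 2 = (X ω - m) ^ 2 + (2 * u * (X ω - m) + u ^ 2) := fun ω => by ring
  have hi2 : Integrable (fun ω => (X ω - m + u) ^ 2) P := by
    simp only [e1]
    exact hi.add ((hi1.const_mul _).add (integrable_const _))
  have hint : ∫ ω, (X ω - m + u) ^ 2 ∂P = v + u ^ 2 := by
    simp only [e1]
    have hi3 : Integrable (fun ω => 2 * u * (X ω - m) + u ^ 2) P :=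
      (hi1.const_mul _).add (integrable_const _)
    rw [integral_add hi hi3, integral_add (hi1.const_mul _) (integrable_const _), integral_const_mul,
      integral_sub (hX.integrable (by norm_num)) (integrable_const _)]
    have : v = ∫ ω, (X ω - m) ^ 2 ∂P := variance_eq_integral hX.aemeasurable
    simp [this, m]
  have hM := mul_meas_ge_le_integral_of_nonneg (μ := P)
    (Filter.Eventually.of_forall fun ω => sq_nonneg (X ω - m + u)) hi2 ((t + u) ^ 2)
  rw [hint] at hM
  have hsub : P.real {ω | m + t ≤ X ω} ≤ P.real {ω | (t + u) ^ 2 ≤ (X ω - m + u) ^ 2} := by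
    refine measureReal_mono fun ω (hω : m + t ≤ X ω) => ?_
    show (t + u) ^ 2 ≤ (X ω - m + u) ^ 2
    exact pow_le_pow_left₀ (by positivity) (by linarith) 2
  have hpos : 0 < v + t ^ 2 := by positivity
  rw [le_div_iff₀ hpos]
  have h1 : v + u ^ 2 = v / t ^ 2 * (v + t ^ 2) := by simp only [u]; field_simp; ring
  have h2 : (t + u) ^ 2 = (v + t ^ 2) / t ^ 2 * (v + t ^ 2) := by simp only [u]; field_simp; ring
  have h3 := (mul_le_mul_of_nonneg_left hsub (sq_nonneg (t + u))).trans hM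
  rw [h1, h2] at h3
  have h4 : (v + t ^ 2) / t ^ 2 * P.real {ω | m + t ≤ X ω} ≤ v / t ^ 2 := by
    have : ((v + t ^ 2) / t ^ 2 * P.real {ω | m + t ≤ X ω}) * (v + t ^ 2)
        ≤ v / t ^ 2 * (v + t ^ 2) := by linarith
    exact le_of_mul_le_mul_right this hpos
  rw [div_mul_eq_mul_div, div_le_div_iff_of_pos_right (by positivity)] at h4
  linarith

/-! ### Orders of magnitude of the mean and variance of one summand -/

/-- The expectation of `Y.choose r` for `Y ∼ Bin(n, p)`. -/
noncomputable def chooseMean (r n : ℕ) (p : ℝ) : ℝ := n.choose r * p ^ r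

/-- The variance of `Y.choose r` for `Y ∼ Bin(n, p)`. -/
noncomputable def chooseVar (r n : ℕ) (p : ℝ) : ℝ :=
  binExp p n (fun y => (y.choose r : ℝ) ^ 2) - chooseMean r n p ^ 2

/-- Ordered pairs of r-subsets are classified by the size r + i of their union. Algebraically,
Vandermonde's identity expands one factor and trinomial revision recombines each term. -/
theorem Nat.choose_sq_eq_sum (y r : ℕ) :
    y.choose r ^ 2 = ∑ i ∈ Finset.range (r + 1),
      (r.choose i * (r + i).choose r) * y.choose (r + i) := by
  rcases lt_or_ge y r with h | h
  · rw [Nat.choose_eq_zero_of_lt h, zero_pow two_ne_zero]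
    refine (Finset.sum_eq_zero fun i _ => ?_).symm
    rw [Nat.choose_eq_zero_of_lt (by omega : y < r + i), mul_zero]
  · obtain ⟨z, rfl⟩ := Nat.exists_eq_add_of_le h
    have h1 : ∀ i, (r + z).choose (r + i) * (r + i).choose r = (r + z).choose r * z.choose i := by
      intro i
      have := Nat.choose_mul (n := r + z) (k := r + i) (s := r) (by omega)
      rwa [Nat.add_sub_cancel_left, Nat.add_sub_cancel_left] at this
    have h2 := Nat.add_choose_eq z r r
    rw [Finset.Nat.sum_antidiagonal_eq_sum_range_succ_mk] at h2
    rw [sq]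
    conv_lhs => rw [show (r + z).choose r = (z + r).choose r by rw [add_comm]]
    conv_lhs => arg 2; rw [h2]
    rw [Finset.mul_sum]
    refine Finset.sum_congr rfl fun i hi => ?_
    have h3 : r.choose (r - i) = r.choose i := Nat.choose_symm (by simp at hi; omega)
    simp only [h3]
    rw [add_comm z r, ← mul_assoc, ← h1]
    ring

/-- The constant in the upper bound for the variance of `Y.choose r`. -/
noncomputable def varConst (r : ℕ) : ℝ :=
  ∑ i ∈ Finset.range r, (r.choose i * (r + i).choose r : ℝ)

theorem varConst_pos {r : ℕ} (hr : 1 ≤ r) : 0 < varConst r := by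
  refine Finset.sum_pos (fun i hi => ?_) ⟨0, Finset.mem_range.2 hr⟩
  have h1 : 0 < r.choose i := Nat.choose_pos (by simp at hi; omega)
  have h2 : 0 < (r + i).choose r := Nat.choose_pos (by omega)
  positivity

theorem choose_mul_pow_le {n k : ℕ} {p : ℝ} (h0 : 0 ≤ p) :
    (n.choose k : ℝ) * p ^ k ≤ (n * p) ^ k / k.factorial := by
  have h := Nat.choose_le_pow_div (α := ℝ) k n
  rw [mul_pow, mul_div_right_comm]
  exact mul_le_mul_of_nonneg_right h (by positivity)

theorem choose_mul_pow_le_pow {n k : ℕ} {p : ℝ} (h0 : 0 ≤ p) :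
    (n.choose k : ℝ) * p ^ k ≤ (n * p) ^ k :=
  (choose_mul_pow_le h0).trans (div_le_self (by positivity)
    (by exact_mod_cast Nat.succ_le_of_lt k.factorial_pos))

theorem pow_le_one_add_pow {a : ℝ} (ha : 0 ≤ a) {i k : ℕ} (h : i ≤ k) : a ^ i ≤ 1 + a ^ k := by
  rcases le_total a 1 with h1 | h1
  · have := pow_le_one₀ ha h1 (n := i)
    have : 0 ≤ a ^ k := by positivity
    linarith
  · have := pow_le_pow_right₀ h1 h
    linarith

/-- In the second moment the term i = r, counting disjoint pairs, is at most the squared mean and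
cancels against it. The other terms are at most multiples of (np)^(r+i) with i < r, hence controlled
by the extreme exponents. -/
theorem chooseVar_le {r n : ℕ} {p : ℝ} (h0 : 0 ≤ p) :
    chooseVar r n p ≤ varConst r * ((n * p) ^ r * (1 + (n * p) ^ (r - 1))) := by
  have ha : 0 ≤ n * p := by positivity
  have h1 : ∀ y : ℕ, (y.choose r : ℝ) ^ 2 = ∑ i ∈ Finset.range (r + 1),
      (r.choose i * (r + i).choose r : ℝ) * y.choose (r + i) := by
    intro y; exact_mod_cast Nat.choose_sq_eq_sum y r
  have h2 : ((r.choose r * (r + r).choose r : ℝ)) * (n.choose (r + r) * p ^ (r + r))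
      ≤ chooseMean r n p ^ 2 := by
    have h3 := Nat.choose_mul (n := n) (k := r + r) (s := r) (by omega)
    rw [Nat.add_sub_cancel] at h3
    have h4 : (n - r).choose r ≤ n.choose r := Nat.choose_le_choose r (by omega)
    have h5 : ((n.choose (r + r) * (r + r).choose r : ℕ) : ℝ) ≤ n.choose r * n.choose r := by
      rw [h3]; push_cast; gcongr
    push_cast at h5
    rw [Nat.choose_self, chooseMean, pow_add]
    have := mul_le_mul_of_nonneg_right h5 (by positivity : 0 ≤ p ^ r * p ^ r)
    push_cast
    linarith
  unfold chooseVar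
  simp only [h1]
  rw [binExp_sum, Finset.sum_range_succ]
  simp only [binExp_const_mul, binExp_choose]
  have h3 : ∑ i ∈ Finset.range r, (r.choose i * (r + i).choose r : ℝ)
      * (n.choose (r + i) * p ^ (r + i)) ≤
      varConst r * ((n * p) ^ r * (1 + (n * p) ^ (r - 1))) := by
    rw [varConst, Finset.sum_mul]
    refine Finset.sum_le_sum fun i hi => ?_
    refine mul_le_mul_of_nonneg_left ?_ (by positivity)
    refine (choose_mul_pow_le_pow h0).trans ?_
    rw [pow_add]
    exact mul_le_mul_of_nonneg_left
      (pow_le_one_add_pow ha (by simp at hi; omega)) (by positivity)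
  linarith

theorem chooseMean_sub_sq_le_chooseVar {r n : ℕ} {p : ℝ} (h0 : 0 ≤ p) (h1 : p ≤ 1) :
    chooseMean r n p - chooseMean r n p ^ 2 ≤ chooseVar r n p := by
  unfold chooseVar
  refine sub_le_sub_right ?_ _
  rw [chooseMean, ← binExp_choose]
  refine binExp_mono h0 h1 n fun y => ?_
  have : y.choose r ≤ y.choose r ^ 2 := Nat.le_self_pow two_ne_zero _
  exact_mod_cast this

/-- The variance is at least the part explained by linear regression on Y. With Z = C(Y, r), m its
mean and a = np, Cov(Z, Y) = r m (1 - p) and Var Y = a(1 - p), so the slope is b = r m / a; the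
bound is the nonnegativity of E(Z - m - b(Y - a))². -/
theorem sq_chooseMean_div_le_chooseVar {r n : ℕ} {p : ℝ} (hn : r ≤ n) (hn1 : 1 ≤ n) (h0 : 0 < p)
    (h1 : p ≤ 1) :
    r ^ 2 * (1 - p) * chooseMean r n p ^ 2 / (n * p) ≤ chooseVar r n p := by
  set a : ℝ := n * p with ha
  have hn0 : (0 : ℝ) < n := by exact_mod_cast hn1
  have ha0 : 0 < a := by positivity
  set m := chooseMean r n p with hm
  set b : ℝ := r * m / a with hb
  have e1 : ∀ y : ℕ, (y : ℝ) * y.choose r = (r + 1) * y.choose (r + 1) + r * y.choose r := by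
    intro y
    have h := Nat.choose_succ_right_eq y r
    rcases lt_or_ge y r with hy | hy
    · simp [Nat.choose_eq_zero_of_lt hy, Nat.choose_eq_zero_of_lt (by omega : y < r + 1)]
    · have h' : (y.choose (r + 1) : ℝ) * (r + 1) = y.choose r * (y - r) := by
        rw [← Nat.cast_sub hy]; exact_mod_cast h
      linarith
  have e2 : ∀ y : ℕ, (y : ℝ) ^ 2 = 2 * y.choose 2 + y.choose 1 := by
    intro y
    rw [Nat.cast_choose_two, Nat.choose_one_right]; ring
  have key : ∀ y : ℕ, ((y.choose r : ℝ) - m - b * (y - a)) ^ 2 =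
      (y.choose r : ℝ) ^ 2 + ((-2 * b * (r + 1)) * y.choose (r + 1) +
      ((-2 * m - 2 * b * r + 2 * b * a) * y.choose r + ((2 * b ^ 2) * y.choose 2 +
      ((b ^ 2 - 2 * b ^ 2 * a + 2 * m * b) * y.choose 1 + (m - b * a) ^ 2)))) := by
    intro y
    have h1 := e1 y
    have h2 := e2 y
    have h3 : ((y.choose 1 : ℕ) : ℝ) = y := by simp
    rw [h3] at h2 ⊢
    linear_combination b ^ 2 * h2 - 2 * b * h1
  have hpos : 0 ≤ binExp p n (fun y => ((y.choose r : ℝ) - m - b * (y - a)) ^ 2) := by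
    rw [← binExp_const p n 0]
    exact binExp_mono h0.le h1 n fun y => sq_nonneg _
  simp only [key, binExp_add, binExp_const_mul, binExp_choose, binExp_const] at hpos
  have hc : (n.choose (r + 1) : ℝ) * (r + 1) = n.choose r * (n - r) := by
    rw [← Nat.cast_sub hn]; exact_mod_cast Nat.choose_succ_right_eq n r
  have hc1 : (r + 1) * ((n.choose (r + 1) : ℝ) * p ^ (r + 1)) = m * (a - r * p) := by
    rw [hm, chooseMean, ha, pow_succ]; linear_combination (p ^ r * p) * hc
  have hc2 : (n.choose r : ℝ) * p ^ r = m := rfl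
  have hc3 : 2 * ((n.choose 2 : ℝ) * p ^ 2) = a * (a - p) := by
    rw [Nat.cast_choose_two, ha]; ring
  have hc4 : (n.choose 1 : ℝ) * p ^ 1 = a := by rw [ha]; simp
  rw [hc2, hc4] at hpos
  have hv : chooseVar r n p = binExp p n (fun y => (y.choose r : ℝ) ^ 2) - m ^ 2 := rfl
  rw [hv, div_le_iff₀ ha0]
  have hba : b * a = r * m := by rw [hb]; field_simp
  have hap : a * p = n * p ^ 2 := by rw [ha]; ring
  generalize binExp p n (fun y => (y.choose r : ℝ) ^ 2) = q at *
  have : 0 ≤ q - m ^ 2 - b * (r * (1 - p) * m) := by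
    have e : q + ((-2 * b * (r + 1)) * ((n.choose (r + 1) : ℝ) * p ^ (r + 1)) +
      ((-2 * m - 2 * b * r + 2 * b * a) * m + ((2 * b ^ 2) * ((n.choose 2 : ℝ) * p ^ 2) +
      ((b ^ 2 - 2 * b ^ 2 * a + 2 * m * b) * a + (m - b * a) ^ 2)))) =
      q - m ^ 2 - b * (r * (1 - p) * m) := by
      linear_combination (-2 * b) * hc1 + b ^ 2 * hc3 + (b * (1 - p)) * hba
    rwa [e] at hpos
  have := mul_nonneg this ha0.le
  have e2 : b * (r * (1 - p) * m) * a = (b * a) * (r * (1 - p) * m) := by ring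
  rw [sub_mul, e2, hba] at this
  linarith

/-- The constant in the lower bound for the mean of `Y.choose r`. -/
noncomputable def meanConst (r : ℕ) : ℝ := 1 / (r ^ r * r.factorial)

theorem meanConst_pos {r : ℕ} (hr : 1 ≤ r) : 0 < meanConst r := by
  unfold meanConst
  have : (0 : ℝ) < r := by exact_mod_cast hr
  positivity

theorem meanConst_mul_pow_le {r n : ℕ} {p : ℝ} (hr : 1 ≤ r) (hn : r ≤ n) (h0 : 0 ≤ p) :
    meanConst r * (n * p) ^ r ≤ chooseMean r n p := by
  have hr0 : (0 : ℝ) < r := by exact_mod_cast hr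
  have h := Nat.pow_le_choose (α := ℝ) r n
  have h2 : (n : ℝ) / r ≤ ((n + 1 - r : ℕ) : ℝ) := by
    rw [div_le_iff₀ hr0]
    obtain ⟨k, rfl⟩ := Nat.exists_eq_add_of_le hn
    have : r + k + 1 - r = k + 1 := by omega
    rw [this]
    have : r + k ≤ (k + 1) * r := by nlinarith
    exact_mod_cast this
  have h3 : ((n : ℝ) / r) ^ r / r.factorial ≤ n.choose r := by
    refine le_trans ?_ h
    gcongr
  unfold chooseMean meanConst
  have h4 := mul_le_mul_of_nonneg_right h3 (by positivity : 0 ≤ p ^ r)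
  refine le_trans (le_of_eq ?_) h4
  rw [mul_pow, div_pow]
  field_simp

theorem chooseMean_le {r n : ℕ} {p : ℝ} (h0 : 0 ≤ p) :
    chooseMean r n p ≤ (n * p) ^ r / r.factorial := choose_mul_pow_le h0

theorem chooseMean_nonneg {r n : ℕ} {p : ℝ} (h0 : 0 ≤ p) : 0 ≤ chooseMean r n p := by
  unfold chooseMean; positivity

theorem chooseMean_pos {r n : ℕ} {p : ℝ} (hn : r ≤ n) (h0 : 0 < p) : 0 < chooseMean r n p := by
  have := Nat.choose_pos hn
  unfold chooseMean; positivity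

theorem chooseVar_le_mean {r n : ℕ} {p : ℝ} (hr : 1 ≤ r) (hn : r ≤ n) (h0 : 0 ≤ p) :
    chooseVar r n p ≤
      varConst r / meanConst r * (chooseMean r n p * (1 + (n * p) ^ (r - 1))) := by
  refine (chooseVar_le h0).trans ?_
  have := mul_le_mul_of_nonneg_right (meanConst_mul_pow_le hr hn h0)
    (by positivity : 0 ≤ 1 + (n * p) ^ (r - 1))
  have h1 := meanConst_pos hr
  rw [div_mul_eq_mul_div, le_div_iff₀ h1]
  have := mul_le_mul_of_nonneg_left this (varConst_pos hr).le
  linarith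

/-- For np ≤ 1 the mean m is at most 1/2 because r ≥ 2, and integrality gives a variance of at least
m - m² ≥ m/2. For np ≥ 1 the regression bound already has the right order. -/
theorem mean_le_chooseVar {r n : ℕ} {p ξ : ℝ} (hr : 2 ≤ r) (hn : r ≤ n) (h0 : 0 < p)
    (hξ : 0 < ξ) (hp : p ≤ 1 - ξ) :
    min (1 / 4) (ξ * meanConst r / 2) * (chooseMean r n p * (1 + (n * p) ^ (r - 1))) ≤
      chooseVar r n p := by
  have hm := chooseMean_pos hn h0
  have hκ := meanConst_pos (show 1 ≤ r by omega)
  have hn0 : (0 : ℝ) < n := by exact_mod_cast (by omega : 0 < n)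
  have ha : 0 < n * p := by positivity
  rcases le_total (n * p) 1 with h | h
  · have h1 : chooseMean r n p ≤ 1 / 2 := by
      refine (chooseMean_le h0.le).trans ?_
      have h2 : (2 : ℝ) ≤ r.factorial := by
        exact_mod_cast (Nat.factorial_le hr)
      have h3 : (n * p) ^ r ≤ 1 := pow_le_one₀ ha.le h
      rw [div_le_iff₀ (by positivity)]
      linarith
    have h2 : (n * p) ^ (r - 1) ≤ 1 := pow_le_one₀ ha.le h
    have h3 := chooseMean_sub_sq_le_chooseVar (r := r) (n := n) h0.le (by linarith)
    have h4 : chooseMean r n p * (1 + (n * p) ^ (r - 1)) ≤ chooseMean r n p * 2 :=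
      mul_le_mul_of_nonneg_left (by linarith) hm.le
    have h5 : min (1 / 4) (ξ * meanConst r / 2) * (chooseMean r n p * (1 + (n * p) ^ (r - 1)))
        ≤ 1 / 4 * (chooseMean r n p * (1 + (n * p) ^ (r - 1))) :=
      mul_le_mul_of_nonneg_right (min_le_left _ _) (by positivity)
    nlinarith
  · have h1 := sq_chooseMean_div_le_chooseVar (r := r) hn (by omega) h0 (by linarith)
    refine le_trans ?_ h1
    have h2 : (1 : ℝ) ≤ (n * p) ^ (r - 1) := one_le_pow₀ h
    have h3 := meanConst_mul_pow_le (show 1 ≤ r by omega) hn h0.le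
    have h5 : min (1 / 4) (ξ * meanConst r / 2) * (chooseMean r n p * (1 + (n * p) ^ (r - 1)))
        ≤ (ξ * meanConst r / 2) * (chooseMean r n p * (2 * (n * p) ^ (r - 1))) :=
      mul_le_mul (min_le_right _ _) (mul_le_mul_of_nonneg_left (by linarith) hm.le)
        (by positivity) (by positivity)
    refine h5.trans ?_
    rw [le_div_iff₀ ha]
    have h6 : (n * p) ^ r = (n * p) ^ (r - 1) * (n * p) := by
      rw [← pow_succ]; congr 1; omega
    have h7 : (1 : ℝ) ≤ (r : ℝ) ^ 2 := by
      have : (1 : ℝ) ≤ r := by exact_mod_cast (by omega : 1 ≤ r)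
      nlinarith
    have h8 : ξ ≤ (r : ℝ) ^ 2 * (1 - p) := by nlinarith
    calc _ = ξ * chooseMean r n p * (meanConst r * (n * p) ^ r) := by rw [h6]; ring
      _ ≤ ξ * chooseMean r n p * chooseMean r n p := by gcongr
      _ = ξ * chooseMean r n p ^ 2 := by ring
      _ ≤ _ := by gcongr

/-! ### Moment generating functions and their optimisation -/

theorem Real.exp_le_one_add_add_sq {x : ℝ} (hx : x ≤ 1) : Real.exp x ≤ 1 + x + x ^ 2 := by
  rcases le_total (-1) x with h | h
  · have := (abs_le.1 (Real.abs_exp_sub_one_sub_id_le (abs_le.2 ⟨h, hx⟩))).2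
    linarith
  · have : Real.exp x ≤ 1 := Real.exp_le_one_iff.2 (by linarith)
    nlinarith

/-- The moment generating function of a monotone Lipschitz function of a binomial variable. -/
theorem binExp_exp_le_of_lipschitz {p : ℝ} (h0 : 0 ≤ p) (h1 : p ≤ 1) (n : ℕ) {h : ℕ → ℝ} {L l : ℝ}
    (hl : 0 ≤ l) (hlL : l * L ≤ 1) (hmono : ∀ y, h y ≤ h (y + 1))
    (hlip : ∀ y, h (y + 1) ≤ h y + L) :
    binExp p n (fun y => Real.exp (l * h y)) ≤
      Real.exp (l * binExp p n h + n * p * (l * L) ^ 2) := by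
  induction n generalizing h with
  | zero => simp [binExp]
  | succ n ih =>
    have step : ∀ y, (1 - p) * Real.exp (l * h y) + p * Real.exp (l * h (y + 1)) ≤
        Real.exp (p * (l * L) ^ 2) * Real.exp (l * ((1 - p) * h y + p * h (y + 1))) := by
      intro y
      have hd0 := hmono y
      have hd1 := hlip y
      have hx0 : 0 ≤ l * (h (y + 1) - h y) := mul_nonneg hl (by linarith)
      have hx1 : l * (h (y + 1) - h y) ≤ l * L := mul_le_mul_of_nonneg_left (by linarith) hl
      set x := l * (h (y + 1) - h y) with hx
      have e1 : Real.exp (l * h (y + 1)) = Real.exp (l * h y) * Real.exp x := by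
        rw [← Real.exp_add, hx]; congr 1; ring
      have e2 : Real.exp (p * (l * L) ^ 2) * Real.exp (l * ((1 - p) * h y + p * h (y + 1))) =
          Real.exp (l * h y) * Real.exp (p * (x + (l * L) ^ 2)) := by
        rw [← Real.exp_add, ← Real.exp_add, hx]; congr 1; ring
      rw [e1, e2]
      have h3 : Real.exp x ≤ 1 + x + x ^ 2 := Real.exp_le_one_add_add_sq (hx1.trans hlL)
      have h4 : x ^ 2 ≤ (l * L) ^ 2 := pow_le_pow_left₀ hx0 hx1 2
      have h5 := Real.add_one_le_exp (p * (x + (l * L) ^ 2))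
      have h6 : (1 - p) + p * Real.exp x ≤ Real.exp (p * (x + (l * L) ^ 2)) := by nlinarith
      have := mul_le_mul_of_nonneg_left h6 (Real.exp_pos (l * h y)).le
      linarith
    have h2 : binExp p (n + 1) (fun y => Real.exp (l * h y)) ≤
        Real.exp (p * (l * L) ^ 2) *
          binExp p n (fun y => Real.exp (l * ((1 - p) * h y + p * h (y + 1)))) := by
      rw [← binExp_const_mul]
      exact binExp_mono h0 h1 n step
    refine h2.trans ?_
    -- Averaging over the exposed trial preserves monotonicity and the Lipschitz constant, so the
    -- induction hypothesis applies to the averaged function.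
    have h3 := ih (h := fun y => (1 - p) * h y + p * h (y + 1))
      (fun y => by nlinarith [hmono y, hmono (y + 1)])
      (fun y => by nlinarith [hlip y, hlip (y + 1)])
    refine (mul_le_mul_of_nonneg_left h3 (Real.exp_pos _).le).trans (le_of_eq ?_)
    rw [← Real.exp_add]
    congr 1
    simp only [binExp]
    push_cast; ring

/-- The moment generating function of a bounded nonnegative function (Bennett). -/
theorem binExp_exp_le_of_bounded {p : ℝ} (h0 : 0 ≤ p) (h1 : p ≤ 1) (n : ℕ) {h : ℕ → ℝ} {b l m : ℝ}
    (hb : 0 < b) (hl : 0 ≤ l) (hh0 : ∀ y, 0 ≤ h y) (hhb : ∀ y, h y ≤ b) (hm : binExp p n h ≤ m) :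
    binExp p n (fun y => Real.exp (l * h y)) ≤
      Real.exp (m * ((Real.exp (l * b) - 1) / b)) := by
  have hc : 0 ≤ (Real.exp (l * b) - 1) / b :=
    div_nonneg (by linarith [Real.one_le_exp (mul_nonneg hl hb.le)]) hb.le
  have step : ∀ y, Real.exp (l * h y) ≤ 1 + (Real.exp (l * b) - 1) / b * h y := by
    intro y
    have hu0 : 0 ≤ h y / b := div_nonneg (hh0 y) hb.le
    have hu1 : h y / b ≤ 1 := (div_le_one hb).2 (hhb y)
    have := convexOn_exp.2 (Set.mem_univ 0) (Set.mem_univ (l * b)) (sub_nonneg.2 hu1) hu0 (by ring)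
    simp only [smul_eq_mul, mul_zero, zero_add, Real.exp_zero, mul_one] at this
    have e : h y / b * (l * b) = l * h y := by field_simp
    rw [e] at this
    refine this.trans (le_of_eq ?_)
    field_simp
    ring
  refine (binExp_mono h0 h1 n step).trans ?_
  rw [binExp_add, binExp_const, binExp_const_mul]
  have := mul_le_mul_of_nonneg_left hm hc
  have := Real.add_one_le_exp (m * ((Real.exp (l * b) - 1) / b))
  linarith

/-- The moment generating function of a function bounded above (Bernstein). -/
theorem binExp_exp_le_of_variance {p : ℝ} (h0 : 0 ≤ p) (h1 : p ≤ 1) (n : ℕ) {h : ℕ → ℝ}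
    {l m v : ℝ} (hl : 0 ≤ l) (hhb : ∀ y, l * (h y - m) ≤ 1) (hm : binExp p n h ≤ m)
    (hv : binExp p n (fun y => (h y - m) ^ 2) ≤ v) :
    binExp p n (fun y => Real.exp (l * h y)) ≤ Real.exp (l * m + l ^ 2 * v) := by
  have step : ∀ y, Real.exp (l * h y) ≤
      Real.exp (l * m) * ((1 - l * m) + (l * h y + l ^ 2 * (h y - m) ^ 2)) := by
    intro y
    have e : Real.exp (l * h y) = Real.exp (l * m) * Real.exp (l * (h y - m)) := by
      rw [← Real.exp_add]; congr 1; ring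
    rw [e]
    refine mul_le_mul_of_nonneg_left ?_ (Real.exp_pos _).le
    refine (Real.exp_le_one_add_add_sq (hhb y)).trans (le_of_eq ?_)
    ring
  refine (binExp_mono h0 h1 n step).trans ?_
  rw [binExp_const_mul, binExp_add, binExp_add, binExp_const, binExp_const_mul, binExp_const_mul,
    Real.exp_add]
  refine mul_le_mul_of_nonneg_left ?_ (Real.exp_pos _).le
  have := mul_le_mul_of_nonneg_left hm hl
  have := mul_le_mul_of_nonneg_left hv (sq_nonneg l)
  have := Real.add_one_le_exp (l ^ 2 * v)
  linarith

/-- Optimisation of an exponential bound of sub-gamma type. -/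
theorem le_exp_neg_min_of_subgamma {x τ V b : ℝ} (hτ : 0 ≤ τ) (hV : 0 < V) (hb : 0 < b)
    (h : ∀ l, 0 ≤ l → l * b ≤ 1 → x ≤ Real.exp (-l * τ + l ^ 2 * V)) :
    x ≤ Real.exp (-min (τ ^ 2 / (4 * V)) (τ / (2 * b))) := by
  -- The unconstrained optimum is τ/(2V). If it exceeds 1/b, then l = 1/b is used, where the linear
  -- term is at least twice the quadratic one.
  rcases le_total (τ / (2 * V) * b) 1 with h1 | h1
  · refine (h (τ / (2 * V)) (by positivity) h1).trans (Real.exp_le_exp.2 ?_)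
    have e : -(τ / (2 * V)) * τ + (τ / (2 * V)) ^ 2 * V = -(τ ^ 2 / (4 * V)) := by
      field_simp; ring
    rw [e]
    exact neg_le_neg (min_le_left _ _)
  · refine (h (1 / b) (by positivity) (by field_simp; rfl)).trans (Real.exp_le_exp.2 ?_)
    have h2 : 2 * V ≤ τ * b := by
      rw [div_mul_eq_mul_div, le_div_iff₀ (by positivity)] at h1
      linarith
    have h3 : (1 / b) ^ 2 * V ≤ τ / (2 * b) := by
      rw [div_pow, one_pow, one_div_mul_eq_div, div_le_div_iff₀ (by positivity) (by positivity)]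
      nlinarith
    have h4 : -(1 / b) * τ + τ / (2 * b) = -(τ / (2 * b)) := by field_simp; ring
    have := min_le_right (τ ^ 2 / (4 * V)) (τ / (2 * b))
    linarith

theorem chernoffRate_nonneg {x : ℝ} (hx : 0 ≤ x) : 0 ≤ chernoffRate x := by
  unfold chernoffRate
  have h1 := Real.one_sub_inv_le_log_of_pos (by linarith : 0 < 1 + x)
  have h2 := mul_le_mul_of_nonneg_left h1 (by linarith : 0 ≤ 1 + x)
  rw [mul_sub, mul_inv_cancel₀ (by linarith)] at h2
  linarith

/-! ### The truncated sum -/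

/-- `Y.choose r` with `Y` truncated at `k`. -/
def truncChoose (r k y : ℕ) : ℝ := ((min y k).choose r : ℝ)

theorem truncChoose_nonneg (r k y : ℕ) : 0 ≤ truncChoose r k y := Nat.cast_nonneg _

theorem truncChoose_le (r k y : ℕ) : truncChoose r k y ≤ y.choose r := by
  unfold truncChoose
  exact_mod_cast Nat.choose_le_choose r (min_le_left _ _)

theorem truncChoose_le_pow (r k y : ℕ) : truncChoose r k y ≤ (k : ℝ) ^ r := by
  unfold truncChoose
  exact_mod_cast (Nat.choose_le_choose r (min_le_right _ _)).trans (Nat.choose_le_pow k r)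

/-- Below k the increment is C(y, r-1) by Pascal's rule; from k on the function is constant. -/
theorem truncChoose_succ {r : ℕ} (hr : 1 ≤ r) (k y : ℕ) :
    truncChoose r k y ≤ truncChoose r k (y + 1) ∧
      truncChoose r k (y + 1) ≤ truncChoose r k y + (k : ℝ) ^ (r - 1) := by
  unfold truncChoose
  refine ⟨by exact_mod_cast Nat.choose_le_choose r (by omega), ?_⟩
  rcases lt_or_ge y k with h | h
  · rw [min_eq_left (by omega : y + 1 ≤ k), min_eq_left h.le]
    obtain ⟨s, rfl⟩ := Nat.exists_eq_add_of_le hr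
    rw [add_comm 1 s, Nat.choose_succ_succ, Nat.add_sub_cancel]
    have : y.choose s ≤ k ^ s := (Nat.choose_le_pow y s).trans (Nat.pow_le_pow_left h.le s)
    have : ((y.choose s : ℕ) : ℝ) ≤ (k : ℝ) ^ s := by exact_mod_cast this
    push_cast
    linarith
  · rw [min_eq_right h, min_eq_right (by omega)]
    have : (0 : ℝ) ≤ (k : ℝ) ^ (r - 1) := by positivity
    linarith

theorem binExp_truncChoose_le {p : ℝ} (h0 : 0 ≤ p) (h1 : p ≤ 1) (n r k : ℕ) :
    binExp p n (truncChoose r k) ≤ chooseMean r n p := by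
  rw [chooseMean, ← binExp_choose]
  exact binExp_mono h0 h1 n (truncChoose_le r k)

/-- Truncation above the mean only moves values towards the mean, so Bernstein's inequality may use
the variance of the untruncated variable. -/
theorem binExp_truncChoose_sub_sq_le {p : ℝ} (h0 : 0 ≤ p) (h1 : p ≤ 1) {n r k : ℕ}
    (hk : chooseMean r n p ≤ k.choose r) :
    binExp p n (fun y => (truncChoose r k y - chooseMean r n p) ^ 2) ≤ chooseVar r n p := by
  set m := chooseMean r n p with hm
  have e : binExp p n (fun y => (y.choose r : ℝ) ^ 2 + ((-2 * m) * y.choose r + m ^ 2)) =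
      chooseVar r n p := by
    rw [binExp_add, binExp_add, binExp_const_mul, binExp_const, binExp_choose, chooseVar, ← hm]
    have : (n.choose r : ℝ) * p ^ r = m := rfl
    rw [this]; ring
  rw [← e]
  refine binExp_mono h0 h1 n fun y => ?_
  have e2 : (y.choose r : ℝ) ^ 2 + ((-2 * m) * y.choose r + m ^ 2) = (y.choose r - m) ^ 2 := by ring
  rw [e2]
  unfold truncChoose
  rcases le_total y k with h | h
  · rw [min_eq_left h]
  · rw [min_eq_right h]
    have : (k.choose r : ℝ) ≤ y.choose r := by exact_mod_cast Nat.choose_le_choose r h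
    exact pow_le_pow_left₀ (by linarith) (by linarith) 2

namespace IsBinomialSample

variable {Ω : Type u} [MeasurableSpace Ω] {P : Measure Ω} {n : ℕ} {p : unitInterval}
  {Y : Fin n → Ω → ℕ}

theorem measureReal_trunc_le_of_exp (hY : IsBinomialSample P n p Y) {r k : ℕ} {l w τ : ℝ}
    (hl : 0 ≤ l) (h : binExp p n (fun y => Real.exp (l * truncChoose r k y)) ≤ Real.exp w) :
    P.real {ω | n * chooseMean r n p + τ ≤ ∑ i, truncChoose r k (Y i ω)} ≤
      Real.exp (-l * (n * chooseMean r n p + τ) + n * w) := by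
  refine (hY.measureReal_le_sum_le (truncChoose r k) hl _).trans ?_
  rw [Real.exp_add, Real.exp_nat_mul]
  refine mul_le_mul_of_nonneg_left (pow_le_pow_left₀ ?_ h n) (Real.exp_pos _).le
  rw [← binExp_const p n 0]
  exact binExp_mono p.2.1 p.2.2 n fun y => (Real.exp_pos _).le

/-- The truncated sum, by Lipschitz concentration. -/
theorem measureReal_trunc_le_lipschitz (hY : IsBinomialSample P n p Y) {r k : ℕ} (hr : 1 ≤ r)
    (hk : 1 ≤ k) (hn : 1 ≤ n) (hp : 0 < (p : ℝ)) {τ : ℝ} (hτ : 0 ≤ τ) :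
    P.real {ω | n * chooseMean r n p + τ ≤ ∑ i, truncChoose r k (Y i ω)} ≤
      Real.exp (-min (τ ^ 2 / (4 * (n * (n * p) * ((k : ℝ) ^ (r - 1)) ^ 2)))
        (τ / (2 * (k : ℝ) ^ (r - 1)))) := by
  have hk0 : (0 : ℝ) < k := by exact_mod_cast hk
  have hn0 : (0 : ℝ) < n := by exact_mod_cast hn
  refine le_exp_neg_min_of_subgamma hτ (by positivity) (by positivity) fun l hl hlb => ?_
  refine (hY.measureReal_trunc_le_of_exp hl (binExp_exp_le_of_lipschitz p.2.1 p.2.2 n hl hlb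
    (fun y => (truncChoose_succ hr k y).1) (fun y => (truncChoose_succ hr k y).2))).trans
    (Real.exp_le_exp.2 ?_)
  have h1 := binExp_truncChoose_le p.2.1 p.2.2 n r k
  have h2 : (n : ℝ) * (l * binExp p n (truncChoose r k)) ≤ n * (l * chooseMean r n p) := by gcongr
  rw [mul_add (n : ℝ)]
  refine (add_le_add_right (add_le_add_left h2 _) _).trans (le_of_eq ?_)
  ring

/-- The truncated sum, by Bernstein's inequality. -/
theorem measureReal_trunc_le_bernstein (hY : IsBinomialSample P n p Y) {r k : ℕ}
    (hk : 1 ≤ k) (hn : 1 ≤ n) {v : ℝ} (hv0 : 0 < v) (hv : chooseVar r n p ≤ v)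
    (hkm : chooseMean r n p ≤ k.choose r) {τ : ℝ} (hτ : 0 ≤ τ) :
    P.real {ω | n * chooseMean r n p + τ ≤ ∑ i, truncChoose r k (Y i ω)} ≤
      Real.exp (-min (τ ^ 2 / (4 * (n * v))) (τ / (2 * (k : ℝ) ^ r))) := by
  have hk0 : (0 : ℝ) < k := by exact_mod_cast hk
  have hn0 : (0 : ℝ) < n := by exact_mod_cast hn
  refine le_exp_neg_min_of_subgamma hτ (by positivity) (by positivity) fun l hl hlb => ?_
  refine (hY.measureReal_trunc_le_of_exp hl (binExp_exp_le_of_variance p.2.1 p.2.2 n hl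
    (fun y => ?_) (binExp_truncChoose_le p.2.1 p.2.2 n r k)
    ((binExp_truncChoose_sub_sq_le p.2.1 p.2.2 hkm).trans hv))).trans
    (Real.exp_le_exp.2 (le_of_eq ?_))
  · have h1 := truncChoose_le_pow r k y
    have h2 := chooseMean_nonneg (r := r) (n := n) p.2.1
    exact (mul_le_mul_of_nonneg_left (by linarith) hl).trans hlb
  · ring

/-- The truncated sum, by Bennett's inequality. -/
theorem measureReal_trunc_le_bennett (hY : IsBinomialSample P n p Y) {r k : ℕ}
    (hk : 1 ≤ k) (hm : 0 < n * chooseMean r n p) {τ : ℝ} (hτ : 0 ≤ τ) :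
    P.real {ω | n * chooseMean r n p + τ ≤ ∑ i, truncChoose r k (Y i ω)} ≤
      Real.exp (-(n * chooseMean r n p / (k : ℝ) ^ r *
        chernoffRate (τ / (n * chooseMean r n p)))) := by
  have hk0 : (0 : ℝ) < (k : ℝ) ^ r := by
    have : (0 : ℝ) < k := by exact_mod_cast hk
    positivity
  set b := (k : ℝ) ^ r
  set μ := n * chooseMean r n p with hμ
  have h1x : (0 : ℝ) < 1 + τ / μ := by positivity
  have hlog : 0 ≤ Real.log (1 + τ / μ) :=
    Real.log_nonneg (by have : 0 ≤ τ / μ := by positivity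
                        linarith)
  -- The minimiser of the Bennett exponent -l(μ + τ) + μ(e^(lb) - 1)/b.
  have hl : 0 ≤ Real.log (1 + τ / μ) / b := by positivity
  refine (hY.measureReal_trunc_le_of_exp hl (binExp_exp_le_of_bounded p.2.1 p.2.2 n hk0 hl
    (truncChoose_nonneg r k) (truncChoose_le_pow r k)
    (binExp_truncChoose_le p.2.1 p.2.2 n r k))).trans (Real.exp_le_exp.2 (le_of_eq ?_))
  rw [div_mul_cancel₀ _ hk0.ne', Real.exp_log h1x, ← mul_assoc, ← hμ, chernoffRate]
  field_simp
  ring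

end IsBinomialSample

/-! ### Large values of the sample -/

theorem clusterSize_eq_of_le {r n : ℕ} (hr : 1 ≤ r) (hn : 1 ≤ n) {t : ℝ} (ht : 0 < t)
    (h : t ^ (1 / (r : ℝ)) ≤ n) : clusterSize r n t = t ^ (1 / (r : ℝ)) := by
  have hn0 : (0 : ℝ) < n := by exact_mod_cast hn
  set x := t ^ (1 / (r : ℝ)) with hx
  have hx0 : 0 < x := Real.rpow_pos_of_pos ht _
  have hxr : x ^ r = t := by
    rw [hx, one_div, Real.rpow_inv_natCast_pow ht.le (by omega)]
  unfold clusterSize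
  rw [← hx, ← hxr]
  refine max_eq_left ?_
  rw [div_le_iff₀ (by positivity)]
  calc x ^ r = x * x ^ (r - 1) := by rw [← pow_succ']; congr 1; omega
    _ ≤ x * (n : ℝ) ^ (r - 1) := by gcongr

theorem clusterSize_eq_of_ge {r n : ℕ} (hr : 1 ≤ r) (hn : 1 ≤ n) {t : ℝ} (ht : 0 < t)
    (h : n ≤ t ^ (1 / (r : ℝ))) : clusterSize r n t = t / (n : ℝ) ^ (r - 1) := by
  have hn0 : (0 : ℝ) < n := by exact_mod_cast hn
  set x := t ^ (1 / (r : ℝ)) with hx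
  have hx0 : 0 < x := Real.rpow_pos_of_pos ht _
  have hxr : x ^ r = t := by
    rw [hx, one_div, Real.rpow_inv_natCast_pow ht.le (by omega)]
  unfold clusterSize
  rw [← hx, ← hxr]
  refine max_eq_right ?_
  rw [le_div_iff₀ (by positivity)]
  calc x * (n : ℝ) ^ (r - 1) ≤ x * x ^ (r - 1) := by gcongr
    _ = x ^ r := by rw [← pow_succ']; congr 1; omega

theorem clusterSize_nonneg {r n : ℕ} {t : ℝ} (ht : 0 ≤ t) : 0 ≤ clusterSize r n t :=
  le_max_of_le_left (Real.rpow_nonneg ht _)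

/-- From e²a on, log(x/(ea)) is at least 1, which makes log(x/(ea))/x decreasing there. The last
part lets an exponential parameter tuned to K serve every smaller value in the window. -/
theorem mul_log_le_mul_log {a y K : ℝ} (ha : 0 < a) (hy : Real.exp 2 * a ≤ y) (hyK : y ≤ K) :
    1 ≤ Real.log (y / (Real.exp 1 * a)) ∧
      Real.log (y / (Real.exp 1 * a)) ≤ Real.log (K / (Real.exp 1 * a)) ∧
      y * Real.log (K / (Real.exp 1 * a)) ≤ K * Real.log (y / (Real.exp 1 * a)) := by
  have hea : 0 < Real.exp 1 * a := by positivity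
  have hy0 : 0 < y := lt_of_lt_of_le (by positivity) hy
  have hK0 : 0 < K := hy0.trans_le hyK
  have h1 : 1 ≤ Real.log (y / (Real.exp 1 * a)) := by
    rw [Real.le_log_iff_exp_le (by positivity), le_div_iff₀ hea, ← mul_assoc, ← Real.exp_add]
    norm_num; exact hy
  have h2 : Real.log (K / (Real.exp 1 * a)) = Real.log (y / (Real.exp 1 * a)) + Real.log (K / y) := by
    rw [← Real.log_mul (by positivity) (by positivity)]
    congr 1; field_simp
  have h3 := Real.log_le_sub_one_of_pos (by positivity : 0 < K / y)
  refine ⟨h1, ?_, ?_⟩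
  · rw [h2]
    have := Real.log_nonneg ((one_le_div hy0).2 hyK)
    linarith
  · rw [h2]
    have h4 := mul_le_mul_of_nonneg_left h3 hy0.le
    have : y * (K / y - 1) = K - y := by field_simp
    nlinarith

/-- A Poisson type bound for the factorial moments. -/
theorem choose_mul_pow_le_exp {n j : ℕ} {p : ℝ} (hn : 1 ≤ n) (h0 : 0 < p) (hj : 1 ≤ j) :
    (n.choose j : ℝ) * p ^ j ≤ Real.exp (-(j * Real.log (j / (Real.exp 1 * (n * p))))) := by
  have hn0 : (0 : ℝ) < n := by exact_mod_cast hn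
  have hj0 : (0 : ℝ) < j := by exact_mod_cast hj
  refine (choose_mul_pow_le h0.le).trans ?_
  have h1 := Real.pow_div_factorial_le_exp _ hj0.le j
  have h2 : Real.exp (-(j * Real.log (j / (Real.exp 1 * (n * p))))) =
      Real.exp j * ((n * p) ^ j / (j : ℝ) ^ j) := by
    rw [← mul_neg, ← Real.log_inv, Real.exp_nat_mul, Real.exp_log (by positivity), inv_div,
      div_pow, mul_pow, ← Real.exp_nat_mul, mul_one]
    ring
  rw [h2]
  calc (n * p) ^ j / j.factorial
      = (j : ℝ) ^ j / j.factorial * ((n * p) ^ j / (j : ℝ) ^ j) := by field_simp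
    _ ≤ _ := by gcongr

/-- `Y.choose r` restricted to `k < Y ≤ K`. -/
noncomputable def windowChoose (r k : ℕ) (K : ℝ) (y : ℕ) : ℝ :=
  if k < y ∧ (y : ℝ) ≤ K then (y.choose r : ℝ) else 0

/-- Write L(x) = log(x/(enp)) and bound the indicator of Y = j by C(Y, j). As C(j, r) ≤ j² K^(r-2),
the parameter L(K)/(2K^(r-1)) makes the exponential weight at most exp(j L(j)/2), so half of the
Poisson rate j L(j) survives. What remains is a geometric series of ratio at most 2/3 starting
beyond k, and `hlog` makes its sum at most 2/n, small enough for a product over n indices. -/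
theorem binExp_exp_windowChoose_le {n r k : ℕ} {p K : ℝ} (hr : 2 ≤ r) (hn : 1 ≤ n) (hk : 1 ≤ k)
    (h0 : 0 < p) (h1 : p ≤ 1) (hkK : k ≤ K) (hka : Real.exp 2 * (n * p) ≤ k)
    (hlog : Real.log n ≤ k / 2 * Real.log (k / (Real.exp 1 * (n * p)))) :
    binExp p n (fun y => Real.exp (Real.log (K / (Real.exp 1 * (n * p))) / (2 * K ^ (r - 1)) *
      windowChoose r k K y)) ≤ Real.exp (2 / n) := by
  have hn0 : (0 : ℝ) < n := by exact_mod_cast hn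
  have hk0 : (0 : ℝ) < k := by exact_mod_cast hk
  have hK0 : 0 < K := hk0.trans_le hkK
  have ha : 0 < n * p := by positivity
  set L : ℝ → ℝ := fun x => Real.log (x / (Real.exp 1 * (n * p))) with hL
  set l := L K / (2 * K ^ (r - 1)) with hl
  have hLk : 1 ≤ L k := (mul_log_le_mul_log ha hka le_rfl).1
  have hLK : 1 ≤ L K := (mul_log_le_mul_log ha (hka.trans hkK) le_rfl).1
  set ρ := Real.exp (-(L k / 2)) with hρ
  have hρ0 : 0 < ρ := Real.exp_pos _
  have hρ1 : ρ ≤ 2 / 3 := by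
    have h2 : Real.exp (1 / 2) ≥ 3 / 2 := by have := Real.add_one_le_exp (1 / 2 : ℝ); linarith
    have h3 : ρ ≤ (Real.exp (1 / 2))⁻¹ := by
      rw [← Real.exp_neg]; exact Real.exp_le_exp.2 (by linarith)
    refine h3.trans ?_
    rw [inv_le_comm₀ (Real.exp_pos _) (by norm_num)]
    linarith
  have hterm : ∀ j ∈ Finset.Ioc k ⌊K⌋₊,
      Real.exp (l * j.choose r) * (n.choose j * p ^ j) ≤ ρ ^ j := by
    intro j hj
    obtain ⟨hj1, hj2⟩ := Finset.mem_Ioc.1 hj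
    have hjk : (k : ℝ) ≤ j := by exact_mod_cast hj1.le
    have hjK : (j : ℝ) ≤ K := (Nat.le_floor_iff hK0.le).1 hj2
    have hj0 : (0 : ℝ) < j := hk0.trans_le hjk
    obtain ⟨-, -, hm⟩ := mul_log_le_mul_log ha (hka.trans hjk) hjK
    obtain ⟨-, hm2, -⟩ := mul_log_le_mul_log ha hka hjk
    have e1 : l * j.choose r ≤ j / 2 * L j := by
      have h3 : ((j.choose r : ℕ) : ℝ) ≤ j * (j * K ^ (r - 2)) := by
        have : ((j.choose r : ℕ) : ℝ) ≤ (j : ℝ) ^ r := by exact_mod_cast Nat.choose_le_pow j r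
        refine this.trans ?_
        obtain ⟨s, rfl⟩ := Nat.exists_eq_add_of_le hr
        rw [Nat.add_sub_cancel_left, pow_add, pow_two, mul_assoc]
        gcongr
      have h4 : K ^ (r - 1) = K * K ^ (r - 2) := by rw [← pow_succ']; congr 1; omega
      have h5 : l * j.choose r ≤ l * (j * (j * K ^ (r - 2))) := by
        refine mul_le_mul_of_nonneg_left h3 ?_
        rw [hl]; positivity
      refine h5.trans ?_
      rw [hl, h4]
      have h6 : L K / (2 * (K * K ^ (r - 2))) * (j * (j * K ^ (r - 2))) =
          j / 2 * (j * L K / K) := by field_simp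
      rw [h6]
      refine mul_le_mul_of_nonneg_left ?_ (by positivity)
      rw [div_le_iff₀ hK0, mul_comm (L j)]
      exact hm
    have e2 := choose_mul_pow_le_exp hn h0 (show 1 ≤ j by omega)
    calc _ ≤ Real.exp (j / 2 * L j) * Real.exp (-(j * L j)) :=
          mul_le_mul (Real.exp_le_exp.2 e1) e2 (by positivity) (Real.exp_pos _).le
      _ = Real.exp (-(j / 2 * L j)) := by rw [← Real.exp_add]; congr 1; ring
      _ ≤ Real.exp (j * (-(L k / 2))) := by
          refine Real.exp_le_exp.2 ?_
          have := mul_le_mul_of_nonneg_left hm2 hj0.le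
          simp only [hL] at this ⊢
          linarith
      _ = ρ ^ j := by rw [hρ, Real.exp_nat_mul]
  have hpt : ∀ y, Real.exp (l * windowChoose r k K y) ≤
      1 + ∑ j ∈ Finset.Ioc k ⌊K⌋₊, Real.exp (l * j.choose r) * (y.choose j : ℝ) := by
    intro y
    have hnn : ∀ j ∈ Finset.Ioc k ⌊K⌋₊, 0 ≤ Real.exp (l * j.choose r) * (y.choose j : ℝ) :=
      fun j _ => by positivity
    unfold windowChoose
    split_ifs with h
    · have hy : y ∈ Finset.Ioc k ⌊K⌋₊ := Finset.mem_Ioc.2 ⟨h.1, (Nat.le_floor_iff hK0.le).2 h.2⟩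
      have := Finset.single_le_sum hnn hy
      rw [Nat.choose_self, Nat.cast_one, mul_one] at this
      linarith
    · rw [mul_zero, Real.exp_zero]
      have := Finset.sum_nonneg hnn
      linarith
  have hsum : ∑ j ∈ Finset.Ioc k ⌊K⌋₊, ρ ^ j ≤ 2 * ρ ^ k := by
    have e : Finset.Ioc k ⌊K⌋₊ = Finset.Ico (k + 1) (⌊K⌋₊ + 1) := by
      ext j; simp only [Finset.mem_Ioc, Finset.mem_Ico]; omega
    rw [e]
    refine (geom_sum_Ico_le_of_lt_one hρ0.le (by linarith)).trans ?_
    rw [div_le_iff₀ (by linarith), pow_succ]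
    have : 0 < ρ ^ k := by positivity
    nlinarith
  have hρk : ρ ^ k ≤ 1 / n := by
    rw [hρ, ← Real.exp_nat_mul]
    have : (k : ℝ) * -(L k / 2) ≤ -Real.log n := by linarith
    refine (Real.exp_le_exp.2 this).trans (le_of_eq ?_)
    rw [Real.exp_neg, Real.exp_log hn0, one_div]
  refine (binExp_mono h0.le h1 n hpt).trans ?_
  rw [binExp_add, binExp_const, binExp_sum]
  simp only [binExp_const_mul, binExp_choose]
  have h3 := (Finset.sum_le_sum hterm).trans hsum
  have h4 := Real.add_one_le_exp (2 / n : ℝ)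
  have h5 : 2 * (1 / (n : ℝ)) = 2 / n := by ring
  linarith

/-- `Y.choose r` restricted to `k < Y`. -/
noncomputable def tailChoose (r k y : ℕ) : ℝ := if k < y then (y.choose r : ℝ) else 0

theorem choose_le_truncChoose_add_tailChoose (r k y : ℕ) :
    (y.choose r : ℝ) ≤ truncChoose r k y + tailChoose r k y := by
  unfold tailChoose
  split_ifs with h
  · linarith [truncChoose_nonneg r k y]
  · unfold truncChoose
    rw [min_eq_left (by omega), add_zero]

namespace IsBinomialSample

variable {Ω : Type u} [MeasurableSpace Ω] {P : Measure Ω} {n : ℕ} {p : unitInterval}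
  {Y : Fin n → Ω → ℕ}

theorem measureReal_window_le (hY : IsBinomialSample P n p Y) {r k : ℕ} {K : ℝ} (hr : 2 ≤ r)
    (hn : 1 ≤ n) (hk : 1 ≤ k) (h0 : 0 < (p : ℝ)) (hkK : k ≤ K)
    (hka : Real.exp 2 * (n * p) ≤ k)
    (hlog : Real.log n ≤ k / 2 * Real.log (k / (Real.exp 1 * (n * p)))) (τ : ℝ) :
    P.real {ω | τ ≤ ∑ i, windowChoose r k K (Y i ω)} ≤
      8 * Real.exp (-(Real.log (K / (Real.exp 1 * (n * p))) / (2 * K ^ (r - 1)) * τ)) := by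
  have hn0 : (0 : ℝ) < n := by exact_mod_cast hn
  have hk0 : (0 : ℝ) < k := by exact_mod_cast hk
  have hK0 : 0 < K := hk0.trans_le hkK
  have hLK := (mul_log_le_mul_log (by positivity) (hka.trans hkK) le_rfl).1
  have hl : 0 ≤ Real.log (K / (Real.exp 1 * (n * p))) / (2 * K ^ (r - 1)) := by positivity
  refine (hY.measureReal_le_sum_le (windowChoose r k K) hl τ).trans ?_
  have h1 := binExp_exp_windowChoose_le hr hn hk h0 p.2.2 hkK hka hlog
  have h2 : binExp (p : ℝ) n (fun y => Real.exp (Real.log (K / (Real.exp 1 * (n * p))) /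
      (2 * K ^ (r - 1)) * windowChoose r k K y)) ^ n ≤ 8 := by
    refine (pow_le_pow_left₀ ?_ h1 n).trans ?_
    · rw [← binExp_const p n 0]
      exact binExp_mono p.2.1 p.2.2 n fun y => (Real.exp_pos _).le
    · rw [← Real.exp_nat_mul, mul_div_cancel₀ _ hn0.ne']
      have : Real.exp 2 = Real.exp 1 * Real.exp 1 := by rw [← Real.exp_add]; norm_num
      have := Real.exp_one_lt_d9
      have := Real.exp_pos 1
      nlinarith
  rw [mul_comm, neg_mul]
  exact mul_le_mul_of_nonneg_right h2 (Real.exp_pos _).le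

/-- The union over the indices costs log n. By `hlog` this is at most half of the Poisson rate at k,
hence half of the rate at K; the other half is left. -/
theorem measureReal_exists_gt_le (hY : IsBinomialSample P n p Y) {k : ℕ} {K : ℝ}
    (hn : 1 ≤ n) (hk : 1 ≤ k) (h0 : 0 < (p : ℝ)) (hkK : k ≤ K)
    (hka : Real.exp 2 * (n * p) ≤ k)
    (hlog : Real.log n ≤ k / 2 * Real.log (k / (Real.exp 1 * (n * p)))) :
    P.real {ω | ∃ i, K < Y i ω} ≤
      Real.exp (-(K / 2 * Real.log (K / (Real.exp 1 * (n * p))))) := by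
  have := hY.isProbabilityMeasure
  have hn0 : (0 : ℝ) < n := by exact_mod_cast hn
  have hk0 : (0 : ℝ) < k := by exact_mod_cast hk
  have hK0 : 0 < K := hk0.trans_le hkK
  have ha : 0 < n * (p : ℝ) := by positivity
  have hj : K ≤ ((⌊K⌋₊ + 1 : ℕ) : ℝ) := by push_cast; exact (Nat.lt_floor_add_one K).le
  have h1 : P.real {ω | ∃ i, K < Y i ω} ≤ P.real {ω | ∃ i, ⌊K⌋₊ + 1 ≤ Y i ω} := by
    refine measureReal_mono fun ω ⟨i, hi⟩ => ⟨i, ?_⟩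
    exact Nat.succ_le_of_lt ((Nat.floor_lt hK0.le).2 hi)
  refine h1.trans ((hY.measureReal_exists_le _).trans ?_)
  have h2 := choose_mul_pow_le_exp (j := ⌊K⌋₊ + 1) hn h0 (by omega)
  obtain ⟨h3, h4, -⟩ := mul_log_le_mul_log ha (hka.trans hkK) hj
  obtain ⟨h5, h6, -⟩ := mul_log_le_mul_log ha hka hkK
  set L : ℝ → ℝ := fun x => Real.log (x / (Real.exp 1 * (n * p))) with hL
  refine (mul_le_mul_of_nonneg_left h2 hn0.le).trans ?_
  have e : ∀ x, (n : ℝ) * Real.exp x = Real.exp (Real.log n + x) := fun x => by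
    rw [Real.exp_add, Real.exp_log hn0]
  rw [e]
  refine Real.exp_le_exp.2 ?_
  have h7 : K * L K ≤ ((⌊K⌋₊ + 1 : ℕ) : ℝ) * L ((⌊K⌋₊ + 1 : ℕ) : ℝ) :=
    mul_le_mul hj h4 (by simp only [hL]; linarith) (by positivity)
  have h8 : k * L k ≤ K * L K := mul_le_mul hkK h6 (by simp only [hL]; linarith) hK0.le
  simp only [hL] at h7 h8
  linarith

theorem measureReal_exists_gt_eq_zero (hY : IsBinomialSample P n p Y) {K : ℝ} (hK : n ≤ K) :
    P.real {ω | ∃ i, K < Y i ω} = 0 := by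
  have := hY.isProbabilityMeasure
  refine (measureReal_eq_zero_iff (measure_ne_top _ _)).2 ?_
  refine measure_mono_null ?_ (ae_iff.1 hY.ae_le)
  intro ω ⟨i, hi⟩ h
  have : ((Y i ω : ℕ) : ℝ) ≤ n := by exact_mod_cast h i
  linarith

/-- The contribution of the large values of the sample. -/
theorem measureReal_tail_le (hY : IsBinomialSample P n p Y) {r k : ℕ} (hr : 2 ≤ r)
    (hn : 1 ≤ n) (hk : 1 ≤ k) (h0 : 0 < (p : ℝ))
    (hka : Real.exp 2 * (n * p) ≤ k)
    (hlog : Real.log n ≤ k / 2 * Real.log (k / (Real.exp 1 * (n * p)))) {t : ℝ} (ht : 0 < t) :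
    P.real {ω | t / 2 ≤ ∑ i, tailChoose r k (Y i ω)} ≤
      if n ≤ k then 0 else 9 * Real.exp (-(1 / 4 * (clusterSize r n t *
        Real.log (max (k : ℝ) (min (t ^ (1 / (r : ℝ))) n) / (Real.exp 1 * (n * p)))))) := by
  have := hY.isProbabilityMeasure
  have hn0 : (0 : ℝ) < n := by exact_mod_cast hn
  have hk0 : (0 : ℝ) < k := by exact_mod_cast hk
  have ha : 0 < n * (p : ℝ) := by positivity
  have hsub : {ω | t / 2 ≤ ∑ i, tailChoose r k (Y i ω)} ⊆ {ω | ∃ i, (k : ℝ) < Y i ω} := by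
    intro ω (hω : t / 2 ≤ _)
    by_contra hcon
    have hcon : ∀ i, Y i ω ≤ k := by simpa using hcon
    have : ∑ i, tailChoose r k (Y i ω) = 0 :=
      Finset.sum_eq_zero fun i _ => if_neg (not_lt.2 (hcon i))
    linarith
  split_ifs with hnk
  · exact (measureReal_mono hsub).trans
      (hY.measureReal_exists_gt_eq_zero (by exact_mod_cast hnk)).le
  have hkn : (k : ℝ) ≤ n := by exact_mod_cast (not_le.1 hnk).le
  set x := t ^ (1 / (r : ℝ)) with hx
  have hx0 : 0 < x := Real.rpow_pos_of_pos ht _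
  have hxr : x ^ r = t := by
    rw [hx, one_div, Real.rpow_inv_natCast_pow ht.le (by omega)]
  have hsplit : ∀ K : ℝ, P.real {ω | t / 2 ≤ ∑ i, tailChoose r k (Y i ω)} ≤
      P.real {ω | ∃ i, K < Y i ω} + P.real {ω | t / 2 ≤ ∑ i, windowChoose r k K (Y i ω)} := by
    intro K
    refine (measureReal_mono ?_).trans (measureReal_union_le _ _)
    intro ω (hω : t / 2 ≤ _)
    by_cases h : ∃ i, K < Y i ω
    · exact Or.inl h
    · refine Or.inr ?_
      have h : ∀ i, (Y i ω : ℝ) ≤ K := by simpa using h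
      show t / 2 ≤ _
      refine hω.trans (le_of_eq (Finset.sum_congr rfl fun i _ => ?_))
      simp [tailChoose, windowChoose, h i]
  -- For x ≤ k it is enough that some value exceeds k. For k ≤ x ≤ n values above x are excluded by
  -- the union bound and the window ends at x. For x ≥ n the window ends at n, which no value
  -- exceeds.
  rcases le_total x k with hxk | hxk
  · have hxn := hxk.trans hkn
    rw [clusterSize_eq_of_le (by omega) hn ht (by rw [← hx]; exact hxn), ← hx, min_eq_left hxn,
      max_eq_left hxk]
    refine (measureReal_mono hsub).trans
      ((hY.measureReal_exists_gt_le hn hk h0 le_rfl hka hlog).trans ?_)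
    have h1 := (mul_log_le_mul_log ha hka le_rfl).1
    refine (Real.exp_le_exp.2 ?_).trans
      (le_mul_of_one_le_left (Real.exp_pos _).le (by norm_num))
    have := mul_le_mul_of_nonneg_right hxk (zero_le_one.trans h1)
    nlinarith [mul_pos hx0 (zero_lt_one.trans_le h1)]
  rcases le_total x n with hxn | hxn
  · rw [clusterSize_eq_of_le (by omega) hn ht (by rw [← hx]; exact hxn), ← hx, min_eq_left hxn,
      max_eq_right hxk]
    refine (hsplit x).trans ?_
    have h1 := hY.measureReal_exists_gt_le hn hk h0 hxk hka hlog
    have h2 := hY.measureReal_window_le hr hn hk h0 hxk hka hlog (t / 2)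
    have h3 := (mul_log_le_mul_log ha (hka.trans hxk) le_rfl).1
    set l := Real.log (x / (Real.exp 1 * (n * p)))
    have e : l / (2 * x ^ (r - 1)) * (t / 2) = 1 / 4 * (x * l) := by
      rw [← hxr, show x ^ r = x * x ^ (r - 1) by rw [← pow_succ']; congr 1; omega]
      field_simp; norm_num
    rw [e] at h2
    have h4 : Real.exp (-(x / 2 * l)) ≤ Real.exp (-(1 / 4 * (x * l))) :=
      Real.exp_le_exp.2 (by nlinarith [mul_pos hx0 (zero_lt_one.trans_le h3)])
    linarith
  · rw [clusterSize_eq_of_ge (by omega) hn ht (by rw [← hx]; exact hxn), min_eq_right hxn,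
      max_eq_right hkn]
    refine (hsplit n).trans ?_
    rw [hY.measureReal_exists_gt_eq_zero le_rfl, zero_add]
    refine (hY.measureReal_window_le hr hn hk h0 hkn hka hlog (t / 2)).trans ?_
    refine mul_le_mul (by norm_num) (le_of_eq ?_) (Real.exp_pos _).le (by norm_num)
    congr 2
    field_simp; norm_num

/-- The decomposition into small and large values of the sample. -/
theorem measureReal_starSum_le (hY : IsBinomialSample P n p Y) (r k : ℕ) (t : ℝ) :
    P.real {ω | n * chooseMean r n p + t ≤ starSum r Y ω} ≤
      P.real {ω | n * chooseMean r n p + t / 2 ≤ ∑ i, truncChoose r k (Y i ω)} +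
      P.real {ω | t / 2 ≤ ∑ i, tailChoose r k (Y i ω)} := by
  have := hY.isProbabilityMeasure
  refine (measureReal_mono ?_).trans (measureReal_union_le _ _)
  intro ω (hω : _ ≤ starSum r Y ω)
  by_contra h
  simp only [Set.mem_union, Set.mem_ofPred_eq, not_or, not_le] at h
  have h1 : starSum r Y ω ≤ ∑ i, truncChoose r k (Y i ω) + ∑ i, tailChoose r k (Y i ω) := by
    rw [← Finset.sum_add_distrib]
    exact Finset.sum_le_sum fun i _ => choose_le_truncChoose_add_tailChoose r k _
  linarith

end IsBinomialSample

/-! ### The two rates and their comparison -/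

theorem chernoffRate_le_sq {x : ℝ} (hx : 0 ≤ x) : chernoffRate x ≤ x ^ 2 := by
  unfold chernoffRate
  have h := Real.log_le_sub_one_of_pos (by linarith : 0 < 1 + x)
  nlinarith

theorem sq_div_le_chernoffRate {x : ℝ} (hx : 0 ≤ x) : x ^ 2 / (x + 2) ≤ chernoffRate x := by
  unfold chernoffRate
  have h := Real.le_log_one_add_of_nonneg hx
  have h2 := mul_le_mul_of_nonneg_left h (by linarith : 0 ≤ 1 + x)
  have e : x ^ 2 / (x + 2) = (1 + x) * (2 * x / (x + 2)) - x := by field_simp; ring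
  linarith

/-- Pays for leaving only t/2 to the truncated sum. The difference of the two sides vanishes at 0
and has derivative 2 log(1 + x/2) - log(1 + x) ≥ 0, because 1 + x ≤ (1 + x/2)². -/
theorem chernoffRate_le_four_mul {x : ℝ} (hx : 0 ≤ x) :
    chernoffRate x ≤ 4 * chernoffRate (x / 2) := by
  have hd : ∀ y : ℝ, 0 ≤ y → HasDerivAt (fun y => 4 * chernoffRate (y / 2) - chernoffRate y)
      (2 * Real.log (1 + y / 2) - Real.log (1 + y)) y := by
    intro y hy
    have hφ : ∀ z : ℝ, 0 ≤ z → HasDerivAt chernoffRate (Real.log (1 + z)) z := by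
      intro z hz
      have h1 : HasDerivAt (fun z : ℝ => 1 + z) 1 z := (hasDerivAt_id z).const_add 1
      have h2 := (h1.mul (h1.log (by linarith : 1 + z ≠ 0))).sub (hasDerivAt_id z)
      convert! h2 using 1
      have : 1 + z ≠ 0 := by linarith
      field_simp
      ring
    have h3 := (hφ (y / 2) (by positivity)).comp y ((hasDerivAt_id y).div_const 2)
    convert! (h3.const_mul 4).sub (hφ y hy) using 1
    ring
  have hmono : MonotoneOn (fun y => 4 * chernoffRate (y / 2) - chernoffRate y) (Set.Ici 0) := by
    refine monotoneOn_of_hasDerivWithinAt_nonneg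
      (f' := fun y => 2 * Real.log (1 + y / 2) - Real.log (1 + y)) (convex_Ici 0)
      (fun y hy => (hd y hy).continuousAt.continuousWithinAt) (fun y hy => ?_) (fun y hy => ?_)
    · rw [interior_Ici] at hy
      exact (hd y (le_of_lt hy)).hasDerivWithinAt
    · rw [interior_Ici] at hy
      have hy0 : (0 : ℝ) < y := hy
      have h1 : Real.log (1 + y) ≤ Real.log ((1 + y / 2) ^ 2) :=
        Real.log_le_log (by linarith) (by nlinarith)
      rw [Real.log_pow] at h1
      push_cast at h1
      linarith
  have := hmono Set.self_mem_Ici (Set.mem_Ici.2 hx) hx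
  have h0 : chernoffRate 0 = 0 := by simp [chernoffRate]
  simp only [zero_div, h0] at this
  linarith

/-- The rate of collective deviations. -/
noncomputable def bulkRate (r n : ℕ) (p t : ℝ) : ℝ :=
  chernoffRate (t / (n * chooseMean r n p)) * (n * chooseMean r n p) ^ 2 /
    (n * chooseMean r n p * (1 + (n * p) ^ (r - 1)))

/-- The rate of deviations caused by few vertices. -/
noncomputable def clusterRate (r n : ℕ) (p t : ℝ) : ℝ :=
  clusterSize r n t * Real.log (Real.exp 1 / p)

theorem log_exp_one_div {p : ℝ} (h0 : 0 < p) : Real.log (Real.exp 1 / p) = 1 - Real.log p := by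
  rw [Real.log_div (Real.exp_pos 1).ne' h0.ne', Real.log_exp]

theorem one_le_log_exp_one_div {p : ℝ} (h0 : 0 < p) (h1 : p ≤ 1) :
    1 ≤ Real.log (Real.exp 1 / p) := by
  rw [log_exp_one_div h0]
  linarith [Real.log_nonpos h0.le h1]

section Rates

variable {r n : ℕ} {p t : ℝ}

theorem bulkRate_nonneg (h0 : 0 ≤ p) (ht : 0 ≤ t) : 0 ≤ bulkRate r n p t := by
  unfold bulkRate
  have hm := chooseMean_nonneg (r := r) (n := n) h0
  have := chernoffRate_nonneg (x := t / (n * chooseMean r n p)) (by positivity)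
  positivity

theorem clusterRate_nonneg (h0 : 0 < p) (h1 : p ≤ 1) (ht : 0 ≤ t) : 0 ≤ clusterRate r n p t :=
  mul_nonneg (clusterSize_nonneg ht) (zero_le_one.trans (one_le_log_exp_one_div h0 h1))

theorem bulkRate_eq (hμ : 0 < n * chooseMean r n p) : bulkRate r n p t =
    chernoffRate (t / (n * chooseMean r n p)) * (n * chooseMean r n p) /
      (1 + (n * p) ^ (r - 1)) := by
  unfold bulkRate
  rw [sq, ← mul_assoc, mul_comm (n * chooseMean r n p) (1 + _), mul_div_mul_right _ _ hμ.ne']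

theorem bulkRate_le_sq_div (h0 : 0 ≤ p) (hμ : 0 < n * chooseMean r n p) (ht : 0 ≤ t) :
    bulkRate r n p t ≤ t ^ 2 / (n * chooseMean r n p * (1 + (n * p) ^ (r - 1))) := by
  unfold bulkRate
  refine div_le_div_of_nonneg_right ?_ (by positivity)
  refine (mul_le_mul_of_nonneg_right (chernoffRate_le_sq (by positivity)) (sq_nonneg _)).trans ?_
  rw [div_pow, div_mul_cancel₀]
  positivity

theorem sq_div_le_bulkRate (h0 : 0 ≤ p) (hμ : 0 < n * chooseMean r n p) (ht : 0 ≤ t)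
    (h : t ≤ n * chooseMean r n p) :
    t ^ 2 / (n * chooseMean r n p * (1 + (n * p) ^ (r - 1))) ≤ 3 * bulkRate r n p t := by
  have h1 : t / (n * chooseMean r n p) ≤ 1 := (div_le_one hμ).2 h
  have h2 := sq_div_le_chernoffRate (x := t / (n * chooseMean r n p)) (by positivity)
  have h3 : (t / (n * chooseMean r n p)) ^ 2 / 3 ≤ chernoffRate (t / (n * chooseMean r n p)) :=
    le_trans (div_le_div_of_nonneg_left (sq_nonneg _) (by positivity) (by linarith)) h2
  unfold bulkRate
  rw [← mul_div_assoc]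
  refine div_le_div_of_nonneg_right ?_ (by positivity)
  have h4 := mul_le_mul_of_nonneg_right h3 (sq_nonneg (n * chooseMean r n p))
  have e : (t / (n * chooseMean r n p)) ^ 2 / 3 * (n * chooseMean r n p) ^ 2 = t ^ 2 / 3 := by
    generalize n * chooseMean r n p = m at hμ
    field_simp
  rw [e] at h4
  linarith

theorem div_le_bulkRate (h0 : 0 ≤ p) (hμ : 0 < n * chooseMean r n p)
    (h : n * chooseMean r n p ≤ t) : t / (1 + (n * p) ^ (r - 1)) ≤ 3 * bulkRate r n p t := by
  have ht : 0 ≤ t := hμ.le.trans h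
  have h1 : 1 ≤ t / (n * chooseMean r n p) := (one_le_div hμ).2 h
  set x := t / (n * chooseMean r n p) with hx
  have h2 := sq_div_le_chernoffRate (x := x) (by linarith)
  have h3 : x / 3 ≤ chernoffRate x := by
    refine le_trans ?_ h2
    rw [div_le_div_iff₀ (by norm_num) (by linarith)]
    nlinarith
  rw [bulkRate_eq hμ, ← hx, ← mul_div_assoc]
  refine div_le_div_of_nonneg_right ?_ (by positivity)
  have h4 := mul_le_mul_of_nonneg_right h3 hμ.le
  have e : x / 3 * (n * chooseMean r n p) = t / 3 := by
    rw [hx, div_right_comm, div_mul_cancel₀ _ hμ.ne']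
  rw [e] at h4
  linarith

theorem rpow_inv_natCast_spec (hr : 1 ≤ r) (ht : 0 < t) :
    0 < t ^ (1 / (r : ℝ)) ∧ (t ^ (1 / (r : ℝ))) ^ r = t :=
  ⟨Real.rpow_pos_of_pos ht _, by rw [one_div, Real.rpow_inv_natCast_pow ht.le (by omega)]⟩

theorem log_exp_one_div_le_sqrt (hn : 1 ≤ n) (ha : 1 / 2 ≤ n * p) (h0 : 0 < p) :
    Real.log (Real.exp 1 / p) ≤ 4 * Real.sqrt n := by
  have hn0 : (1 : ℝ) ≤ n := by exact_mod_cast hn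
  have h1 : Real.log (1 / p) ≤ Real.log (2 * n) := by
    refine Real.log_le_log (by positivity) ?_
    rw [div_le_iff₀ h0]; linarith
  have h2 := Real.log_le_rpow_div (x := 2 * n) (by positivity) (by norm_num : (0 : ℝ) < 1 / 2)
  rw [← Real.sqrt_eq_rpow, Real.sqrt_mul (by norm_num)] at h2
  have h3 : Real.sqrt 2 ≤ 3 / 2 := by
    rw [Real.sqrt_le_left (by norm_num)]; norm_num
  have h4 : 1 ≤ Real.sqrt n := Real.one_le_sqrt.2 hn0
  rw [log_exp_one_div h0]
  rw [one_div, Real.log_inv] at h1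
  have h5 : Real.log (2 * n) ≤ 2 * Real.log n / 2 + Real.log 2 := by
    rw [Real.log_mul (by norm_num) (by positivity)]; linarith
  have h6 := Real.log_le_rpow_div (x := (n : ℝ)) (by positivity) (by norm_num : (0 : ℝ) < 1 / 2)
  rw [← Real.sqrt_eq_rpow] at h6
  have h7 := Real.log_two_lt_d9
  linarith

/-- Large deviations are governed by the cluster rate. -/
theorem clusterRate_le_div (hr : 2 ≤ r) (hn : 1 ≤ n) (h0 : 0 < p) (h1 : p ≤ 1)
    (ha : 1 / 2 ≤ n * p) {κ : ℝ} (hκ : 0 < κ) (hκ1 : κ ≤ 1) (ht : κ * (n * (n * p) ^ r) ≤ t) :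
    clusterRate r n p t ≤ 4 / κ * (t / (n * p) ^ (r - 1)) := by
  have hn0 : (1 : ℝ) ≤ n := by exact_mod_cast hn
  have ha0 : 0 < n * p := by positivity
  have ht0 : 0 < t := lt_of_lt_of_le (by positivity) ht
  have hL := log_exp_one_div_le_sqrt hn ha h0
  have hL1 := one_le_log_exp_one_div h0 h1
  have hs : 1 ≤ Real.sqrt n := Real.one_le_sqrt.2 hn0
  have hss : Real.sqrt n * Real.sqrt n = n := Real.mul_self_sqrt (by positivity)
  obtain ⟨hx0, hxr⟩ := rpow_inv_natCast_spec (show 1 ≤ r by omega) ht0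
  unfold clusterRate clusterSize
  set x := t ^ (1 / (r : ℝ)) with hx
  rw [max_mul_of_nonneg _ _ (by linarith)]
  refine max_le ?_ ?_
  -- The hypothesis reads y^r ≥ κn. As 2(r-1) ≥ r, this forces y^(r-1) ≥ κ√n, which absorbs the
  -- logarithm.
  · set y := x / (n * p) with hy
    have hy0 : 0 < y := by positivity
    have hyr : κ * n ≤ y ^ r := by
      rw [hy, div_pow, le_div_iff₀ (by positivity), hxr]; linarith
    have hpr : y ^ r = y * y ^ (r - 1) := by rw [← pow_succ']; congr 1; omega
    have hys : κ * Real.sqrt n ≤ y ^ (r - 1) := by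
      rcases le_total y 1 with h | h
      · have : y ^ r ≤ y ^ (r - 1) := by
          rw [hpr]; exact mul_le_of_le_one_left (by positivity) h
        have : κ * Real.sqrt n ≤ κ * n := mul_le_mul_of_nonneg_left (by nlinarith) hκ.le
        linarith
      · have h2 : y ^ r ≤ (y ^ (r - 1)) ^ 2 := by
          rw [← pow_mul]; exact pow_le_pow_right₀ h (by omega)
        refine abs_le_of_sq_le_sq' ?_ (by positivity) |>.2
        have : (κ * Real.sqrt n) ^ 2 = κ * (κ * n) := by rw [mul_pow, sq (Real.sqrt n), hss]; ring
        rw [this]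
        have : κ * (κ * n) ≤ 1 * (κ * n) := by gcongr
        linarith
    have e : 4 / κ * (t / (n * p) ^ (r - 1)) = x * (4 / κ * y ^ (r - 1)) := by
      rw [hy, div_pow, ← hxr, show x ^ r = x * x ^ (r - 1) by rw [← pow_succ']; congr 1; omega]
      field_simp
    rw [e]
    refine mul_le_mul_of_nonneg_left (hL.trans ?_) hx0.le
    rw [div_mul_eq_mul_div, le_div_iff₀ hκ]
    nlinarith
  · have h2 : p ^ (r - 1) * Real.log (Real.exp 1 / p) ≤ 1 := by
      have h3 : p ^ (r - 1) ≤ p := by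
        calc p ^ (r - 1) ≤ p ^ 1 := pow_le_pow_of_le_one h0.le h1 (by omega)
          _ = p := pow_one p
      have h4 := Real.log_le_sub_one_of_pos (inv_pos.2 h0)
      rw [Real.log_inv] at h4
      rw [log_exp_one_div h0] at hL1 ⊢
      calc _ ≤ p * (1 - Real.log p) := by gcongr
        _ ≤ p * p⁻¹ := by gcongr; linarith
        _ = 1 := mul_inv_cancel₀ h0.ne'
    have e : t / (n : ℝ) ^ (r - 1) * Real.log (Real.exp 1 / p) =
        t / (n * p) ^ (r - 1) * (p ^ (r - 1) * Real.log (Real.exp 1 / p)) := by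
      rw [mul_pow]; field_simp
    rw [e, mul_comm (4 / κ)]
    refine mul_le_mul_of_nonneg_left (h2.trans ?_) (by positivity)
    rw [le_div_iff₀ hκ]; linarith

theorem log_exp_one_div_le_log (hn : 2 ≤ n) (h0 : 0 < p) (ha : 1 ≤ n * (n * p)) :
    Real.log (Real.exp 1 / p) ≤ 4 * Real.log n := by
  have hn0 : (2 : ℝ) ≤ n := by exact_mod_cast hn
  have h1 : Real.log (1 / p) ≤ Real.log ((n : ℝ) ^ 2) := by
    refine Real.log_le_log (by positivity) ?_
    rw [div_le_iff₀ h0]; linarith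
  rw [one_div, Real.log_inv, Real.log_pow] at h1
  push_cast at h1
  have h2 : Real.log 2 ≤ Real.log n := Real.log_le_log (by norm_num) hn0
  have := Real.log_two_gt_d9
  rw [log_exp_one_div h0]
  linarith

theorem meanConst_le_one (hr : 1 ≤ r) : meanConst r ≤ 1 := by
  unfold meanConst
  have h1 : (1 : ℝ) ≤ r ^ r := one_le_pow₀ (by exact_mod_cast hr)
  have h2 : (1 : ℝ) ≤ r.factorial := by exact_mod_cast r.factorial_pos
  rw [div_le_one (by positivity)]
  nlinarith

theorem bulkRate_le_sq_div_pow (hr : 1 ≤ r) (hn : r ≤ n) (h0 : 0 < p) (ht : 0 ≤ t) :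
    bulkRate r n p t ≤ t ^ 2 / (meanConst r * (n * (n * p) ^ (2 * r - 1))) := by
  have hn0 : (0 : ℝ) < n := by exact_mod_cast (by omega : 0 < n)
  have hm := chooseMean_pos hn h0
  have hκ := meanConst_pos hr
  have ha : 0 < n * p := by positivity
  refine (bulkRate_le_sq_div h0.le (by positivity) ht).trans ?_
  refine div_le_div_of_nonneg_left (by positivity) (by positivity) ?_
  have h1 := meanConst_mul_pow_le hr hn h0.le
  have e : (n * p) ^ (2 * r - 1) = (n * p) ^ r * (n * p) ^ (r - 1) := by
    rw [← pow_add]; congr 1; omega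
  rw [e]
  calc _ = n * (meanConst r * (n * p) ^ r) * (n * p) ^ (r - 1) := by ring
    _ ≤ n * chooseMean r n p * (1 + (n * p) ^ (r - 1)) := by gcongr; linarith

/-- The tail bound is strong enough when `n * p` is not too small. -/
theorem min_rate_le_of_inv_le (hr : 2 ≤ r) (hn : r ≤ n) (h0 : 0 < p) (ht : 0 < t)
    (ha : 1 ≤ n * (n * p)) {k : ℕ} (hka : Real.exp 2 * (n * p) ≤ k) (hkn : k < n) :
    min (bulkRate r n p t) (clusterRate r n p t) ≤ 16 * r / meanConst r * (clusterSize r n t *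
      Real.log (max (k : ℝ) (min (t ^ (1 / (r : ℝ))) n) / (Real.exp 1 * (n * p)))) := by
  have hn0 : (0 : ℝ) < n := by exact_mod_cast (by omega : 0 < n)
  have hr0 : (2 : ℝ) ≤ r := by exact_mod_cast hr
  have ha0 : 0 < n * p := by positivity
  have hκ := meanConst_pos (show 1 ≤ r by omega)
  have hκ1 := meanConst_le_one (show 1 ≤ r by omega)
  have hkn' : (k : ℝ) ≤ n := by exact_mod_cast hkn.le
  obtain ⟨hx0, hxr⟩ := rpow_inv_natCast_spec (show 1 ≤ r by omega) ht
  set x := t ^ (1 / (r : ℝ)) with hx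
  have hC : 1 / meanConst r ≤ 16 * r / meanConst r := by gcongr; linarith
  have hC1 : 16 * (r : ℝ) ≤ 16 * r / meanConst r := by
    rw [le_div_iff₀ hκ]; nlinarith
  have hK1 : (k : ℝ) ≤ max (k : ℝ) (min x n) := le_max_left _ _
  obtain ⟨hl1, -, -⟩ := mul_log_le_mul_log ha0 (hka.trans hK1) le_rfl
  rcases le_total x n with hxn | hxn
  · have hM : clusterSize r n t = x := clusterSize_eq_of_le (by omega) (by omega) ht hxn
    rw [hM]
    set K := max (k : ℝ) (min x n) with hK
    have hxK : x ≤ K := by rw [hK, min_eq_left hxn]; exact le_max_right _ _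
    set l := Real.log (K / (Real.exp 1 * (n * p))) with hl
    set z := K / (n * p) with hz
    have hz0 : 0 < z := by positivity
    have hlz : Real.log z = l + 1 := by
      have : K / (Real.exp 1 * (n * p)) = z / Real.exp 1 := by rw [hz]; field_simp
      rw [hl, this, Real.log_div hz0.ne' (Real.exp_pos 1).ne', Real.log_exp]; ring
    have hxl : 0 < x * l := mul_pos hx0 (by linarith)
    -- If K is close to np, the bulk rate, at most of order t²/(n(np)^(2r-1)), is already at most of
    -- order x, and l ≥ 1 concludes. Otherwise l + 1 = log z is at least log n/(2r), which is
    -- comparable to the bound 4 log n on log(e/p).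
    rcases le_total (z ^ (2 * r - 1)) n with h | h
    · refine (min_le_left _ _).trans ((bulkRate_le_sq_div_pow (by omega) hn h0 ht.le).trans ?_)
      have e : t ^ 2 / (meanConst r * (n * (n * p) ^ (2 * r - 1))) =
          1 / meanConst r * (x * ((x / (n * p)) ^ (2 * r - 1) / n)) := by
        rw [← hxr, div_pow, ← pow_mul, show r * 2 = (2 * r - 1) + 1 by omega, pow_succ]
        field_simp
      rw [e]
      have h2 : (x / (n * p)) ^ (2 * r - 1) / n ≤ 1 := by
        rw [div_le_one hn0]
        refine le_trans (pow_le_pow_left₀ (by positivity) ?_ _) h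
        exact div_le_div_of_nonneg_right hxK ha0.le
      calc 1 / meanConst r * (x * ((x / (n * p)) ^ (2 * r - 1) / n))
          ≤ 1 / meanConst r * (x * 1) := by gcongr
        _ ≤ 16 * r / meanConst r * (x * l) := by gcongr
    · refine (min_le_right _ _).trans ?_
      have h2 := Real.log_le_log hn0 h
      rw [Real.log_pow, hlz] at h2
      have h3 := log_exp_one_div_le_log (by omega) h0 ha
      unfold clusterRate
      rw [hM]
      have h4 : ((2 * r - 1 : ℕ) : ℝ) ≤ 2 * r := by exact_mod_cast (by omega : 2 * r - 1 ≤ 2 * r)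
      have h5 : Real.log n ≤ 2 * r * (2 * l) := h2.trans (by gcongr; linarith)
      calc x * Real.log (Real.exp 1 / p) ≤ x * (4 * (2 * r * (2 * l))) := by gcongr; linarith
        _ = 16 * r * (x * l) := by ring
        _ ≤ _ := by gcongr
  · refine (min_le_right _ _).trans ?_
    -- Here K = n, so the logarithm l in the tail rate satisfies log(e/p) = l + 2 with l ≥ 1.
    rw [min_eq_right hxn, max_eq_right hkn'] at hl1 ⊢
    have e : (n : ℝ) / (Real.exp 1 * (n * p)) = 1 / p / Real.exp 1 := by field_simp
    rw [e] at hl1 ⊢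
    have e2 : Real.log (1 / p / Real.exp 1) = - Real.log p - 1 := by
      rw [Real.log_div (by positivity) (Real.exp_pos 1).ne', Real.log_exp, one_div, Real.log_inv]
    have hM := clusterSize_nonneg (r := r) (n := n) ht.le
    unfold clusterRate
    rw [log_exp_one_div h0]
    rw [e2] at hl1 ⊢
    calc clusterSize r n t * (1 - Real.log p)
        ≤ clusterSize r n t * (16 * r * (-Real.log p - 1)) := by gcongr; nlinarith
      _ = 16 * r * (clusterSize r n t * (-Real.log p - 1)) := by ring
      _ ≤ _ := by
        refine mul_le_mul_of_nonneg_right hC1 (mul_nonneg hM (by linarith))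

end Rates

theorem exp_two_lt_eight : Real.exp 2 < 8 := by
  have : Real.exp 2 = Real.exp 1 * Real.exp 1 := by rw [← Real.exp_add]; norm_num
  have := Real.exp_one_lt_d9
  have := Real.exp_pos 1
  nlinarith

theorem four_lt_exp_two : 4 < Real.exp 2 := by
  have : Real.exp 2 = Real.exp 1 * Real.exp 1 := by rw [← Real.exp_add]; norm_num
  have := Real.exp_one_gt_d9
  nlinarith

theorem half_le_log {n : ℕ} (hn : 2 ≤ n) : 1 / 2 ≤ Real.log n := by
  have h1 : Real.log 2 ≤ Real.log n := Real.log_le_log (by norm_num) (by exact_mod_cast hn)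
  have := Real.log_two_gt_d9
  linarith

/-- A power of the logarithm is absorbed by a small power of a deviation beyond the standard
deviation. -/
theorem clusterSize_mul_log_pow_le {r n : ℕ} (hr : 2 ≤ r) (hn : 2 ≤ n) {t κ : ℝ} (ht : 0 < t)
    (hκ : 0 < κ) (hκ1 : κ ≤ 1) (h : κ * Real.sqrt n ≤ t ^ 2) :
    clusterSize r n t * Real.log n ^ (r + 1) ≤ (8 * (r + 1)) ^ (r + 1) / κ * t := by
  have hn0 : (1 : ℝ) ≤ n := by exact_mod_cast (by omega : 1 ≤ n)
  have hlog0 := Real.log_nonneg hn0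
  obtain ⟨hx0, hxr⟩ := rpow_inv_natCast_spec (show 1 ≤ r by omega) ht
  -- Up to constants w dominates every fixed power of log n. It is also small enough that t² ≥ κw⁴
  -- gives x^(r-1) ≥ κw for x = t^(1/r), since 4(r-1) ≥ 2r.
  set w : ℝ := (n : ℝ) ^ (1 / 8 : ℝ) with hw
  have hw1 : 1 ≤ w := Real.one_le_rpow hn0 (by norm_num)
  have hw4 : w ^ 4 = Real.sqrt n := by
    rw [hw, ← Real.rpow_natCast, ← Real.rpow_mul (by positivity), Real.sqrt_eq_rpow]; norm_num
  have hw8 : w ^ 8 = n := by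
    rw [hw, ← Real.rpow_natCast, ← Real.rpow_mul (by positivity)]; norm_num
  have hlog : Real.log n ^ (r + 1) ≤ (8 * (r + 1)) ^ (r + 1) * w := by
    have h1 := Real.log_natCast_le_rpow_div n (ε := 1 / (8 * (r + 1))) (by positivity)
    have h2 := pow_le_pow_left₀ hlog0 h1 (r + 1)
    refine h2.trans (le_of_eq ?_)
    rw [div_pow, ← Real.rpow_natCast (_ ^ _), ← Real.rpow_mul (by positivity), one_div, inv_pow,
      div_inv_eq_mul, mul_comm, hw]
    congr 2
    push_cast
    field_simp
  have hxw : κ * w ≤ (t ^ (1 / (r : ℝ))) ^ (r - 1) := by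
    set x := t ^ (1 / (r : ℝ))
    have h1 : κ * w ^ 4 ≤ x ^ (2 * r) := by
      rw [hw4, mul_comm 2, pow_mul, hxr]; exact h
    rcases le_total x 1 with h2 | h2
    · have h3 : x ^ (2 * r) ≤ x ^ (r - 1) := pow_le_pow_of_le_one hx0.le h2 (by omega)
      have h4 : κ * w ≤ κ * w ^ 4 :=
        mul_le_mul_of_nonneg_left (le_self_pow₀ hw1 (by norm_num)) hκ.le
      linarith
    · have h3 : x ^ (2 * r) ≤ (x ^ (r - 1)) ^ 4 := by
        rw [← pow_mul]; exact pow_le_pow_right₀ h2 (by omega)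
      refine le_of_pow_le_pow_left₀ (n := 4) (by norm_num) (by positivity) ?_
      have h4 : (κ * w) ^ 4 ≤ κ * w ^ 4 := by
        rw [mul_pow]
        exact mul_le_mul_of_nonneg_right (pow_le_of_le_one hκ.le hκ1 (by norm_num)) (by positivity)
      linarith
  have hkey : clusterSize r n t * w ≤ t / κ := by
    unfold clusterSize
    set x := t ^ (1 / (r : ℝ))
    rw [max_mul_of_nonneg _ _ (by linarith), le_div_iff₀ hκ]
    rw [max_mul_of_nonneg _ _ hκ.le]
    refine max_le ?_ ?_
    · calc x * w * κ = x * (κ * w) := by ring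
        _ ≤ x * x ^ (r - 1) := by gcongr
        _ = t := by rw [← hxr, ← pow_succ']; congr 1; omega
    · have h1 : w ≤ (n : ℝ) ^ (r - 1) := by
        calc w ≤ w ^ 8 := le_self_pow₀ hw1 (by norm_num)
          _ = n := hw8
          _ ≤ (n : ℝ) ^ (r - 1) := le_self_pow₀ hn0 (by omega)
      have h2 : t / (n : ℝ) ^ (r - 1) * w ≤ t := by
        rw [div_mul_eq_mul_div, div_le_iff₀ (by positivity)]
        gcongr
      have h3 : 0 ≤ t / (n : ℝ) ^ (r - 1) * w := by positivity
      nlinarith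
  have hM := clusterSize_nonneg (r := r) (n := n) ht.le
  calc _ ≤ clusterSize r n t * ((8 * (r + 1)) ^ (r + 1) * w) := by gcongr
    _ = (8 * (r + 1)) ^ (r + 1) * (clusterSize r n t * w) := by ring
    _ ≤ (8 * (r + 1)) ^ (r + 1) * (t / κ) := by gcongr
    _ = _ := by ring

/-! ### The upper tail with a prefactor, in three density regimes -/

namespace IsBinomialSample

/-- The `+ 1` in `hq` and `hT` is slack that costs a factor e < 3. The truncated part thus
contributes 3 and the tail 9 · 3, in total 30. For `n ≤ k` the tail vanishes almost surely, so `hT`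
is required only for `k < n`. -/
theorem measureReal_le_of_rates {Ω : Type u} [MeasurableSpace Ω] {P : Measure Ω} {n : ℕ}
    {p : unitInterval} {Y : Fin n → Ω → ℕ} (hY : IsBinomialSample P n p Y) {r k : ℕ} (hr : 2 ≤ r)
    (hn : 1 ≤ n) (hk : 1 ≤ k) (h0 : 0 < (p : ℝ)) (hka : Real.exp 2 * (n * p) ≤ k)
    (hlog : Real.log n ≤ k / 2 * Real.log (k / (Real.exp 1 * (n * p)))) {t q Φ D : ℝ} (ht : 0 < t)
    (hD : 0 < D)
    (hS : P.real {ω | n * chooseMean r n p + t / 2 ≤ ∑ i, truncChoose r k (Y i ω)} ≤ Real.exp (-q))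
    (hq : Φ ≤ D * (q + 1))
    (hT : k < n → Φ ≤ D * (clusterSize r n t *
      Real.log (max (k : ℝ) (min (t ^ (1 / (r : ℝ))) n) / (Real.exp 1 * (n * p))) / 4 + 1)) :
    P.real {ω | n * chooseMean r n p + t ≤ starSum r Y ω} ≤ 30 * Real.exp (-(1 / D * Φ)) := by
  refine (hY.measureReal_starSum_le r k t).trans ?_
  have key : ∀ q', Φ ≤ D * (q' + 1) → Real.exp (-q') ≤ 3 * Real.exp (-(1 / D * Φ)) := by
    intro q' h
    have h1 : 1 / D * Φ ≤ q' + 1 := by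
      rw [one_div_mul_eq_div, div_le_iff₀ hD]; linarith
    have h2 : Real.exp (-q') ≤ Real.exp (1 + -(1 / D * Φ)) := Real.exp_le_exp.2 (by linarith)
    rw [Real.exp_add] at h2
    have := Real.exp_one_lt_d9
    nlinarith [Real.exp_pos (-(1 / D * Φ))]
  have h1 := key q hq
  have h2 := hY.measureReal_tail_le hr hn hk h0 hka hlog ht
  have h3 := Real.exp_pos (-(1 / D * Φ))
  split_ifs at h2 with hnk
  · linarith
  · have h4 := key _ (hT (not_le.1 hnk))
    rw [div_eq_mul_one_div, mul_comm _ (1 / 4 : ℝ)] at h4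
    linarith

/-- The upper tail for sparse samples. -/
theorem measureReal_le_of_sparse (r : ℕ) (hr : 2 ≤ r) : ∃ D : ℝ, 0 < D ∧
    ∀ (n : ℕ) (p : unitInterval) (t : ℝ) (Ω : Type u) [MeasurableSpace Ω] (P : Measure Ω)
      (Y : Fin n → Ω → ℕ), r ≤ n → 0 < (p : ℝ) → 0 < t → IsBinomialSample P n p Y →
      n * (n * (p : ℝ)) ^ (2 * r) ≤ 1 →
    P.real {ω | n * chooseMean r n p + t ≤ starSum r Y ω} ≤
      30 * Real.exp (-(1 / D * min (bulkRate r n p t) (clusterRate r n p t))) := by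
  -- The threshold is k = 4r: sparsity gives log n ≤ 2r log(1/(np)), and k/2 = 2r. In D the first
  -- term is the factor 4 from halving t times the bound k^r on a truncated summand; the second
  -- comes from log(e/p) ≤ (2r + 2) l and the 1/4 in the tail rate.
  set D : ℝ := 4 * ((4 * r : ℕ) : ℝ) ^ r + 4 * (2 * r + 2) with hD
  have hD0 : 0 < D := by positivity
  refine ⟨D, hD0, fun n p t Ω _ P Y hn h0 ht hY hsp => ?_⟩
  have hn0 : (1 : ℝ) ≤ n := by exact_mod_cast (by omega : 1 ≤ n)
  have ha0 : 0 < n * (p : ℝ) := by positivity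
  have hr0 : (2 : ℝ) ≤ r := by exact_mod_cast hr
  have ha1 : n * (p : ℝ) ≤ 1 := by
    refine (pow_le_one_iff_of_nonneg ha0.le (by omega : 2 * r ≠ 0)).1 ?_
    have : 0 ≤ (n * (p : ℝ)) ^ (2 * r) := by positivity
    nlinarith
  have hk4 : ((4 * r : ℕ) : ℝ) = 4 * r := by push_cast; ring
  have hμ : 0 < n * chooseMean r n p := mul_pos (by positivity) (chooseMean_pos hn h0)
  have hka : Real.exp 2 * (n * p) ≤ ((4 * r : ℕ) : ℝ) := by
    rw [hk4]; nlinarith [exp_two_lt_eight, Real.exp_pos 2]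
  have hek : Real.exp 1 ≤ ((4 * r : ℕ) : ℝ) := by
    rw [hk4]; linarith [Real.exp_one_lt_d9]
  have hloga : ∀ K : ℝ, ((4 * r : ℕ) : ℝ) ≤ K →
      -Real.log (n * p) ≤ Real.log (K / (Real.exp 1 * (n * p))) := by
    intro K hK
    rw [← Real.log_inv]
    refine Real.log_le_log (by positivity) ?_
    rw [inv_eq_one_div, div_le_div_iff₀ ha0 (by positivity)]
    nlinarith
  have hlogn : Real.log n ≤ 2 * r * -Real.log (n * p) := by
    have h := Real.log_nonpos (by positivity) hsp
    rw [Real.log_mul (by positivity) (by positivity), Real.log_pow] at h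
    push_cast at h; linarith
  have hlog : Real.log n ≤ ((4 * r : ℕ) : ℝ) / 2 *
      Real.log (((4 * r : ℕ) : ℝ) / (Real.exp 1 * (n * p))) := by
    refine hlogn.trans ?_
    have := mul_le_mul_of_nonneg_left (hloga _ le_rfl) (by positivity : (0 : ℝ) ≤ 2 * r)
    have e : ((4 * r : ℕ) : ℝ) / 2 = 2 * r := by rw [hk4]; ring
    rw [e]; exact this
  have hS := hY.measureReal_trunc_le_bennett (r := r) (k := 4 * r) (by omega) hμ
    (τ := t / 2) (by positivity)
  refine hY.measureReal_le_of_rates hr (by omega) (by omega) h0 hka hlog ht hD0 hS ?_ fun hkn => ?_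
  · set x := t / (n * chooseMean r n p) with hx
    have hx0 : 0 ≤ x := by positivity
    have hx2 : t / 2 / (n * chooseMean r n p) = x / 2 := by rw [hx, div_right_comm]
    rw [hx2]
    have hφ := chernoffRate_nonneg hx0
    have hφ2 := chernoffRate_nonneg (by positivity : 0 ≤ x / 2)
    have h1 : bulkRate r n p t ≤ chernoffRate x * (n * chooseMean r n p) := by
      rw [bulkRate_eq hμ, ← hx]
      refine div_le_self (by positivity) ?_
      have : 0 ≤ (n * (p : ℝ)) ^ (r - 1) := by positivity
      linarith
    have h2 := mul_le_mul_of_nonneg_right (chernoffRate_le_four_mul hx0) hμ.le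
    have hkr : (0 : ℝ) < ((4 * r : ℕ) : ℝ) ^ r := by rw [hk4]; positivity
    have h3 : 4 * chernoffRate (x / 2) * (n * chooseMean r n p) = 4 * ((4 * r : ℕ) : ℝ) ^ r *
        (n * chooseMean r n p / ((4 * r : ℕ) : ℝ) ^ r * chernoffRate (x / 2)) := by
      field_simp
    have h4 : 0 ≤ n * chooseMean r n p / ((4 * r : ℕ) : ℝ) ^ r * chernoffRate (x / 2) := by
      positivity
    refine (min_le_left _ _).trans (h1.trans (h2.trans (h3.le.trans ?_)))
    exact mul_le_mul (by rw [hD]; linarith) (by linarith) h4 hD0.le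
  · refine (min_le_right _ _).trans ?_
    set K := max ((4 * r : ℕ) : ℝ) (min (t ^ (1 / (r : ℝ))) n) with hK
    have hkK : ((4 * r : ℕ) : ℝ) ≤ K := le_max_left _ _
    obtain ⟨hl1, -, -⟩ := mul_log_le_mul_log ha0 (hka.trans hkK) le_rfl
    have hl2 := hloga K hkK
    set l := Real.log (K / (Real.exp 1 * (n * p)))
    have hlp : Real.log (Real.exp 1 / p) ≤ (2 * r + 2) * l := by
      rw [log_exp_one_div h0]
      have : Real.log (n * p) = Real.log n + Real.log p := Real.log_mul (by positivity) h0.ne'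
      nlinarith
    have hM := clusterSize_nonneg (r := r) (n := n) ht.le
    unfold clusterRate
    calc clusterSize r n t * Real.log (Real.exp 1 / p)
        ≤ clusterSize r n t * ((2 * r + 2) * l) := by gcongr
      _ = 4 * (2 * r + 2) * (clusterSize r n t * l / 4) := by ring
      _ ≤ D * (clusterSize r n t * l / 4 + 1) := by
        refine mul_le_mul ?_ (by linarith) (by positivity) hD0.le
        rw [hD]
        have : (0 : ℝ) ≤ 4 * ((4 * r : ℕ) : ℝ) ^ r := by positivity
        linarith

/-- The upper tail for dense samples. -/
theorem measureReal_le_of_dense (r : ℕ) (hr : 2 ≤ r) : ∃ D : ℝ, 0 < D ∧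
    ∀ (n : ℕ) (p : unitInterval) (t : ℝ) (Ω : Type u) [MeasurableSpace Ω] (P : Measure Ω)
      (Y : Fin n → Ω → ℕ), r ≤ n → 0 < (p : ℝ) → 0 < t → IsBinomialSample P n p Y →
      Real.log n ≤ n * (p : ℝ) →
    P.real {ω | n * chooseMean r n p + t ≤ starSum r Y ω} ≤
      30 * Real.exp (-(1 / D * min (bulkRate r n p t) (clusterRate r n p t))) := by
  have hκ := meanConst_pos (show 1 ≤ r by omega)
  have hκ1 := meanConst_le_one (show 1 ≤ r by omega)
  have hr0 : (2 : ℝ) ≤ r := by exact_mod_cast hr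
  set D : ℝ := 64 * r * (10 ^ (r - 1)) ^ 2 / meanConst r with hD
  have hD0 : 0 < D := by positivity
  have h10 : (1 : ℝ) ≤ 10 ^ (r - 1) := one_le_pow₀ (by norm_num)
  refine ⟨D, hD0, fun n p t Ω _ P Y hn h0 ht hY hden => ?_⟩
  have hn0 : (1 : ℝ) ≤ n := by exact_mod_cast (by omega : 1 ≤ n)
  have hn2 : 2 ≤ n := hr.trans hn
  have ha : 1 / 2 ≤ n * (p : ℝ) := (half_le_log hn2).trans hden
  have ha0 : 0 < n * (p : ℝ) := by positivity
  set a := n * (p : ℝ) with haa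
  have hna : 1 ≤ n * a := by
    have : (2 : ℝ) ≤ n := by exact_mod_cast hn2
    nlinarith
  -- The least integer threshold with k ≥ e²np. It has order np, so the variance proxy
  -- n(np)k^(2(r-1)) has order n(np)^(2r-1), which is that of Λ for np ≥ 1/2.
  set k := ⌈Real.exp 2 * a⌉₊ with hk
  have hka : Real.exp 2 * a ≤ k := Nat.le_ceil _
  have hk10 : (k : ℝ) ≤ 10 * a := by
    have := (Nat.ceil_lt_add_one (by positivity : 0 ≤ Real.exp 2 * a)).le
    nlinarith [exp_two_lt_eight]
  have hak : 4 * a ≤ k := by nlinarith [four_lt_exp_two]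
  have hk1 : 1 ≤ k := by
    have : (0 : ℝ) < k := by linarith
    exact_mod_cast this
  have hk0 : (0 : ℝ) < k := by exact_mod_cast hk1
  have hl := (mul_log_le_mul_log ha0 hka le_rfl).1
  have hlog : Real.log n ≤ k / 2 * Real.log (k / (Real.exp 1 * a)) := by
    have : (k : ℝ) / 2 * 1 ≤ k / 2 * Real.log (k / (Real.exp 1 * a)) := by gcongr
    linarith
  have hS := hY.measureReal_trunc_le_lipschitz (r := r) (k := k) (by omega) hk1 (by omega) h0
    (τ := t / 2) (by positivity)
  refine hY.measureReal_le_of_rates hr (by omega) hk1 h0 hka hlog ht hD0 hS ?_ fun hkn => ?_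
  · set L := (k : ℝ) ^ (r - 1) with hL
    have hL0 : 0 < L := by positivity
    have hL1 : L ≤ 10 ^ (r - 1) * a ^ (r - 1) := by
      rw [← mul_pow]; exact pow_le_pow_left₀ hk0.le hk10 _
    have hL2 : a ^ (r - 1) ≤ L := pow_le_pow_left₀ ha0.le (by linarith) _
    rcases le_total ((t / 2) ^ 2 / (4 * (n * (n * p) * L ^ 2))) (t / 2 / (2 * L)) with h | h
    · rw [min_eq_left h]
      refine (min_le_left _ _).trans ((bulkRate_le_sq_div_pow (by omega) hn h0 ht.le).trans ?_)
      have h1 : t ^ 2 / (meanConst r * (n * (n * p) ^ (2 * r - 1))) ≤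
          16 * (10 ^ (r - 1)) ^ 2 / meanConst r * ((t / 2) ^ 2 / (4 * (n * (n * p) * L ^ 2))) := by
        rw [← haa]
        have e : a ^ (2 * r - 1) = a * (a ^ (r - 1)) ^ 2 := by
          rw [← pow_mul, ← pow_succ']; congr 1; omega
        have h2 : L ^ 2 ≤ (10 ^ (r - 1)) ^ 2 * (a ^ (r - 1)) ^ 2 := by
          rw [← mul_pow]; exact pow_le_pow_left₀ hL0.le hL1 2
        rw [e, div_mul_div_comm, div_le_div_iff₀ (by positivity) (by positivity)]
        have h3 := mul_le_mul_of_nonneg_left h2 (by positivity : 0 ≤ t ^ 2 * meanConst r * 4 * n * a)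
        calc _ = t ^ 2 * meanConst r * 4 * n * a * L ^ 2 := by ring
          _ ≤ _ := h3
          _ = _ := by ring
      have h2 : 0 ≤ (t / 2) ^ 2 / (4 * (n * (n * p) * L ^ 2)) := by positivity
      refine h1.trans (mul_le_mul ?_ (by linarith) h2 hD0.le)
      rw [hD]
      gcongr
      linarith
    · rw [min_eq_right h]
      -- When the linear term of the Lipschitz bound prevails, t is at least of order n(np)^r, and
      -- there the cluster rate is at most of order t/(np)^(r-1).
      have h1 : 4 * (n * a * L) ≤ t := by
        rw [← haa, div_le_div_iff₀ (by positivity) (by positivity)] at h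
        have h2 : (t * L) * (4 * (n * a * L)) ≤ (t * L) * t := by nlinarith
        exact le_of_mul_le_mul_left h2 (by positivity)
      have h2 : 1 * (n * (n * (p : ℝ)) ^ r) ≤ t := by
        rw [← haa, one_mul, show a ^ r = a * a ^ (r - 1) by rw [← pow_succ']; congr 1; omega]
        have : n * (a * a ^ (r - 1)) ≤ n * a * L := by rw [← mul_assoc]; gcongr
        have : 0 ≤ n * a * L := by positivity
        linarith
      refine (min_le_right _ _).trans
        ((clusterRate_le_div hr (by omega) h0 p.2.2 ha one_pos le_rfl h2).trans ?_)
      rw [← haa]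
      have h3 : 4 / 1 * (t / a ^ (r - 1)) ≤ 16 * 10 ^ (r - 1) * (t / 2 / (2 * L)) := by
        rw [div_div, ← mul_div_assoc, ← mul_div_assoc,
          div_le_div_iff₀ (by positivity) (by positivity)]
        nlinarith [mul_le_mul_of_nonneg_left hL1 ht.le]
      have h4 : 0 ≤ t / 2 / (2 * L) := by positivity
      refine h3.trans (mul_le_mul ?_ (by linarith) h4 hD0.le)
      rw [hD, le_div_iff₀ hκ]
      have h5 : (10 : ℝ) ^ (r - 1) ≤ (10 ^ (r - 1)) ^ 2 := le_self_pow₀ h10 (by norm_num)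
      calc 16 * (10 : ℝ) ^ (r - 1) * meanConst r ≤ 16 * (10 ^ (r - 1)) ^ 2 * 1 := by gcongr
        _ ≤ 64 * r * (10 ^ (r - 1)) ^ 2 := by nlinarith [sq_nonneg ((10 : ℝ) ^ (r - 1))]
  · refine (min_rate_le_of_inv_le hr hn h0 ht hna hka hkn).trans ?_
    set K := max (k : ℝ) (min (t ^ (1 / (r : ℝ))) n) with hK
    have hkK : (k : ℝ) ≤ K := le_max_left _ _
    obtain ⟨hl1, -, -⟩ := mul_log_le_mul_log ha0 (hka.trans hkK) le_rfl
    set l := Real.log (K / (Real.exp 1 * (n * p)))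
    have hM := clusterSize_nonneg (r := r) (n := n) ht.le
    have hMl : 0 ≤ clusterSize r n t * l := mul_nonneg hM (by linarith)
    calc 16 * r / meanConst r * (clusterSize r n t * l)
        = 64 * r * 1 / meanConst r * (clusterSize r n t * l / 4) := by ring
      _ ≤ D * (clusterSize r n t * l / 4 + 1) := by
        refine mul_le_mul ?_ (by linarith) (by positivity) hD0.le
        rw [hD]
        gcongr
        exact one_le_pow₀ h10

/-- The upper tail for samples of intermediate density. -/
theorem measureReal_le_of_intermediate (r : ℕ) (hr : 2 ≤ r) : ∃ D : ℝ, 0 < D ∧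
    ∀ (n : ℕ) (p : unitInterval) (t : ℝ) (Ω : Type u) [MeasurableSpace Ω] (P : Measure Ω)
      (Y : Fin n → Ω → ℕ), r ≤ n → 0 < (p : ℝ) → 0 < t → IsBinomialSample P n p Y →
      1 ≤ n * (n * (p : ℝ)) ^ (2 * r) → n * (p : ℝ) ≤ Real.log n →
    P.real {ω | n * chooseMean r n p + t ≤ starSum r Y ω} ≤
      30 * Real.exp (-(1 / D * min (bulkRate r n p t) (clusterRate r n p t))) := by
  have hκ := meanConst_pos (show 1 ≤ r by omega)
  have hκ1 := meanConst_le_one (show 1 ≤ r by omega)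
  have hV := varConst_pos (show 1 ≤ r by omega)
  have hr0 : (2 : ℝ) ≤ r := by exact_mod_cast hr
  set C₁ : ℝ := varConst r / meanConst r with hC₁
  set C₂ : ℝ := 16 * (10 + 2 * r) ^ r * ((8 * (r + 1)) ^ (r + 1) / meanConst r) with hC₂
  have hC₁0 : 0 < C₁ := by positivity
  have hC₂0 : 0 < C₂ := by positivity
  set D : ℝ := 64 * r / meanConst r + 16 * C₁ + C₂ + 1 with hD
  have hD1 : 0 < 64 * r / meanConst r := by positivity
  have hD0 : 0 < D := by positivity
  refine ⟨D, hD0, fun n p t Ω _ P Y hn h0 ht hY hinv hden => ?_⟩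
  have hn0 : (1 : ℝ) ≤ n := by exact_mod_cast (by omega : 1 ≤ n)
  have hn2 : 2 ≤ n := hr.trans hn
  have hlogn := half_le_log hn2
  have ha0 : 0 < n * (p : ℝ) := by positivity
  have hm := chooseMean_pos hn h0
  have hμ : 0 < n * chooseMean r n p := by positivity
  have hmκ := meanConst_mul_pow_le (show 1 ≤ r by omega) hn h0.le
  have hvar := chooseVar_le_mean (show 1 ≤ r by omega) hn h0.le
  have hmle := chooseMean_le (r := r) (n := n) h0.le
  set a := n * (p : ℝ) with haa
  set m := chooseMean r n p with hmm
  have hna : 1 ≤ n * a := by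
    by_contra hcon
    have hcon := not_le.1 hcon
    have ha1 : a ≤ 1 := (le_mul_of_one_le_left ha0.le hn0).trans hcon.le
    have h1 : a ^ (2 * r) ≤ a := pow_le_of_le_one ha0.le ha1 (by omega)
    exact absurd (hinv.trans (mul_le_mul_of_nonneg_left h1 (by linarith))) (not_le.2 hcon)
  -- The multiple of log n pays for the union over indices. The added r gives k + 1 - r ≥ log n ≥
  -- np, hence C(k, r) ≥ m, as truncation above the mean requires.
  set k := ⌈Real.exp 2 * Real.log n⌉₊ + r with hk
  have hceil : Real.exp 2 * Real.log n ≤ ⌈Real.exp 2 * Real.log n⌉₊ := Nat.le_ceil _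
  have hkc : (k : ℝ) = ⌈Real.exp 2 * Real.log n⌉₊ + r := by rw [hk]; push_cast; rfl
  have hexp : 4 * Real.log n ≤ Real.exp 2 * Real.log n :=
    mul_le_mul_of_nonneg_right four_lt_exp_two.le (by linarith)
  have hklog : Real.exp 2 * Real.log n ≤ k := by rw [hkc]; linarith
  have hka : Real.exp 2 * a ≤ k := le_trans (by gcongr) hklog
  have hkle : (k : ℝ) ≤ (10 + 2 * r) * Real.log n := by
    have := (Nat.ceil_lt_add_one (by positivity : 0 ≤ Real.exp 2 * Real.log n)).le
    have h8 : Real.exp 2 * Real.log n ≤ 8 * Real.log n :=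
      mul_le_mul_of_nonneg_right exp_two_lt_eight.le (by linarith)
    have hr2 : (r : ℝ) ≤ r * (2 * Real.log n) := le_mul_of_one_le_right (by positivity) (by linarith)
    rw [hkc]
    linarith
  have hk1 : 1 ≤ k := by omega
  have hk0 : (0 : ℝ) < k := by exact_mod_cast hk1
  have hl := (mul_log_le_mul_log ha0 hka le_rfl).1
  have hlog : Real.log n ≤ k / 2 * Real.log (k / (Real.exp 1 * a)) := by
    have : (k : ℝ) / 2 * 1 ≤ k / 2 * Real.log (k / (Real.exp 1 * a)) := by gcongr
    linarith
  have hkm : m ≤ k.choose r := by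
    refine hmle.trans (le_trans ?_ (Nat.pow_le_choose (α := ℝ) r k))
    have h1 : a ≤ ((k + 1 - r : ℕ) : ℝ) := by
      have : k + 1 - r = ⌈Real.exp 2 * Real.log n⌉₊ + 1 := by omega
      rw [this]; push_cast
      linarith
    gcongr
  have hv0 : 0 < C₁ * (m * (1 + a ^ (r - 1))) := by positivity
  have hS := hY.measureReal_trunc_le_bernstein (r := r) (k := k) hk1 (by omega) hv0 hvar hkm
    (τ := t / 2) (by positivity)
  refine hY.measureReal_le_of_rates hr (by omega) hk1 h0 hka hlog ht hD0 hS ?_ fun hkn => ?_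
  · rcases le_total ((t / 2) ^ 2 / (4 * (n * (C₁ * (m * (1 + a ^ (r - 1)))))))
      (t / 2 / (2 * (k : ℝ) ^ r)) with h | h
    · rw [min_eq_left h]
      refine (min_le_left _ _).trans ((bulkRate_le_sq_div h0.le hμ ht.le).trans ?_)
      have e : t ^ 2 / (n * m * (1 + a ^ (r - 1))) =
          16 * C₁ * ((t / 2) ^ 2 / (4 * (n * (C₁ * (m * (1 + a ^ (r - 1))))))) := by
        field_simp; norm_num
      have h2 : 0 ≤ (t / 2) ^ 2 / (4 * (n * (C₁ * (m * (1 + a ^ (r - 1)))))) := by positivity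
      refine e.le.trans (mul_le_mul ?_ (by linarith) h2 hD0.le)
      rw [hD]; linarith
    · rw [min_eq_right h]
      have hq : 0 ≤ t / 2 / (2 * (k : ℝ) ^ r) := by positivity
      -- A bulk rate of at most 1 is covered by the slack. Otherwise t² ≥ Λ ≥ μ, which is at least
      -- of order √n in this regime, so t beats M(t) k^r log(e/p), where the last two factors are at
      -- most of order (log n)^(r+1).
      rcases le_total (bulkRate r n p t) 1 with hb | hb
      · refine (min_le_left _ _).trans (hb.trans ?_)
        have : 1 ≤ D := by rw [hD]; linarith
        exact one_le_mul_of_one_le_of_one_le this (by linarith)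
      · have h1 := hb.trans (bulkRate_le_sq_div h0.le hμ ht.le)
        rw [one_le_div (by positivity)] at h1
        have h2 : meanConst r * Real.sqrt n ≤ t ^ 2 := by
          have h3 : Real.sqrt n ≤ n * a ^ r := by
            have e : (n * a ^ r) ^ 2 = n * (n * a ^ (2 * r)) := by
              rw [mul_pow, ← pow_mul, mul_comm r 2]; ring
            refine Real.sqrt_le_iff.2 ⟨by positivity, ?_⟩
            rw [e]
            exact le_mul_of_one_le_right (by positivity) hinv
          have h4 : n * m ≤ n * m * (1 + a ^ (r - 1)) := by
            refine le_mul_of_one_le_right hμ.le ?_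
            have : 0 ≤ a ^ (r - 1) := by positivity
            linarith
          calc meanConst r * Real.sqrt n ≤ meanConst r * (n * a ^ r) := by gcongr
            _ = n * (meanConst r * a ^ r) := by ring
            _ ≤ n * m := by gcongr
            _ ≤ t ^ 2 := h4.trans h1
        have h3 := clusterSize_mul_log_pow_le hr hn2 ht hκ hκ1 h2
        have h4 := log_exp_one_div_le_log hn2 h0 hna
        have hM := clusterSize_nonneg (r := r) (n := n) ht.le
        have h5 : (k : ℝ) ^ r ≤ (10 + 2 * r) ^ r * Real.log n ^ r := by
          rw [← mul_pow]; exact pow_le_pow_left₀ hk0.le hkle r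
        have h6 : clusterRate r n p t * (k : ℝ) ^ r ≤ C₂ / 4 * t := by
          unfold clusterRate
          calc clusterSize r n t * Real.log (Real.exp 1 / p) * (k : ℝ) ^ r
              ≤ clusterSize r n t * (4 * Real.log n) * ((10 + 2 * r) ^ r * Real.log n ^ r) := by
                gcongr
            _ = 4 * (10 + 2 * r) ^ r * (clusterSize r n t * Real.log n ^ (r + 1)) := by
                rw [pow_succ]; ring
            _ ≤ 4 * (10 + 2 * r) ^ r * ((8 * (r + 1)) ^ (r + 1) / meanConst r * t) := by gcongr
            _ = C₂ / 4 * t := by rw [hC₂]; ring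
        have h7 : clusterRate r n p t ≤ C₂ * (t / 2 / (2 * (k : ℝ) ^ r)) := by
          rw [div_div, ← mul_div_assoc, le_div_iff₀ (by positivity)]
          linarith
        refine (min_le_right _ _).trans (h7.trans (mul_le_mul ?_ (by linarith) hq hD0.le))
        rw [hD]; linarith
  · refine (min_rate_le_of_inv_le hr hn h0 ht hna hka hkn).trans ?_
    set K := max (k : ℝ) (min (t ^ (1 / (r : ℝ))) n) with hK
    have hkK : (k : ℝ) ≤ K := le_max_left _ _
    obtain ⟨hl1, -, -⟩ := mul_log_le_mul_log ha0 (hka.trans hkK) le_rfl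
    rw [← haa]
    set l := Real.log (K / (Real.exp 1 * a))
    have hM := clusterSize_nonneg (r := r) (n := n) ht.le
    have hMl : 0 ≤ clusterSize r n t * l := mul_nonneg hM (by linarith)
    calc 16 * r / meanConst r * (clusterSize r n t * l)
        = 64 * r / meanConst r * (clusterSize r n t * l / 4) := by ring
      _ ≤ D * (clusterSize r n t * l / 4 + 1) := by
        refine mul_le_mul ?_ (by linarith) (by positivity) hD0.le
        rw [hD]; linarith

end IsBinomialSample

/-! ### Removal of the prefactor and the general upper bound -/

/-- For Φ ≥ 8/c₀ half of the exponent absorbs 30 ≤ e⁴. For smaller Φ, with u = c₁Φ, one has 1/(1 +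
u) = 1 - u/(1 + u) ≤ exp(-u/(1 + u)), and the denominator stays bounded. -/
theorem le_exp_neg_mul_of_le_div {x Φ c₀ c₁ : ℝ} (hΦ : 0 ≤ Φ) (h₀ : 0 < c₀) (h₁ : 0 < c₁)
    (hx₀ : x ≤ 30 * Real.exp (-(c₀ * Φ))) (hx₁ : x ≤ 1 / (1 + c₁ * Φ)) :
    x ≤ Real.exp (-(min (c₀ / 2) (c₁ / (1 + c₁ * (8 / c₀))) * Φ)) := by
  rcases le_total (8 / c₀) Φ with h | h
  · refine hx₀.trans ?_
    have h30 : (30 : ℝ) ≤ Real.exp 4 := by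
      have e : Real.exp 4 = Real.exp 1 ^ 4 := by rw [← Real.exp_nat_mul]; norm_num
      rw [e]
      calc (30 : ℝ) ≤ (2.7 : ℝ) ^ 4 := by norm_num
        _ ≤ _ := pow_le_pow_left₀ (by norm_num) (by linarith [Real.exp_one_gt_d9]) 4
    refine (mul_le_mul_of_nonneg_right h30 (Real.exp_pos _).le).trans ?_
    rw [← Real.exp_add]
    refine Real.exp_le_exp.2 ?_
    rw [div_le_iff₀ h₀] at h
    have := mul_le_mul_of_nonneg_right (min_le_left (c₀ / 2) (c₁ / (1 + c₁ * (8 / c₀)))) hΦ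
    linarith
  · refine hx₁.trans ?_
    have hu : 0 ≤ c₁ * Φ := by positivity
    have h2 := Real.add_one_le_exp (-(c₁ * Φ / (1 + c₁ * Φ)))
    have e : -(c₁ * Φ / (1 + c₁ * Φ)) + 1 = 1 / (1 + c₁ * Φ) := by field_simp; ring
    rw [e] at h2
    refine h2.trans (Real.exp_le_exp.2 (neg_le_neg ?_))
    refine (mul_le_mul_of_nonneg_right (min_le_right _ _) hΦ).trans ?_
    rw [div_mul_eq_mul_div]
    exact div_le_div_of_nonneg_left hu (by positivity) (by gcongr)

theorem le_exp_neg_mul_of_le {x c c' Φ Ψ : ℝ} (hc : 0 ≤ c) (h : x ≤ Real.exp (-(c * Ψ)))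
    (hΦ : c' * Φ ≤ Ψ) : x ≤ Real.exp (-(c * c' * Φ)) := by
  refine h.trans (Real.exp_le_exp.2 (neg_le_neg ?_))
  rw [mul_assoc]
  exact mul_le_mul_of_nonneg_left hΦ hc

namespace IsBinomialSample

/-- Cantelli's inequality, with the variance at most a multiple of Λ and the bulk rate at most t²/Λ.
-/
theorem measureReal_le_div_one_add {Ω : Type u} [MeasurableSpace Ω] {P : Measure Ω} {n : ℕ}
    {p : unitInterval} {Y : Fin n → Ω → ℕ} (hY : IsBinomialSample P n p Y) {r : ℕ} (hr : 1 ≤ r)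
    (hn : r ≤ n) (h0 : 0 < (p : ℝ)) {t : ℝ} (ht : 0 < t) :
    P.real {ω | n * chooseMean r n p + t ≤ starSum r Y ω} ≤
      1 / (1 + meanConst r / varConst r * bulkRate r n p t) := by
  have := hY.isProbabilityMeasure
  have hn0 : (0 : ℝ) < n := by exact_mod_cast (by omega : 0 < n)
  have hm := chooseMean_pos hn h0
  have hμ : 0 < n * chooseMean r n p := by positivity
  have hκ := meanConst_pos hr
  have hV := varConst_pos hr
  have ha0 : 0 < n * (p : ℝ) := by positivity
  have hC := measureReal_add_le_le_variance_div (hY.memLp_starSum r) ht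
  have hmean : ∫ ω, starSum r Y ω ∂P = n * chooseMean r n p := hY.integral_starSum r
  have hvar : variance (starSum r Y) P = n * chooseVar r n p := hY.variance_starSum r
  rw [hmean] at hC
  refine hC.trans ?_
  have hv0 : 0 ≤ variance (starSum r Y) P := variance_nonneg _ _
  set v := variance (starSum r Y) P
  have hv1 : v ≤ varConst r / meanConst r *
      (n * chooseMean r n p * (1 + (n * (p : ℝ)) ^ (r - 1))) := by
    rw [hvar]
    have := mul_le_mul_of_nonneg_left (chooseVar_le_mean hr hn h0.le) hn0.le
    linarith
  have hb := bulkRate_le_sq_div h0.le hμ ht.le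
  have hb0 := bulkRate_nonneg (r := r) (n := n) h0.le ht.le
  set Λ := n * chooseMean r n p * (1 + (n * (p : ℝ)) ^ (r - 1)) with hΛ
  have hΛ0 : 0 < Λ := by positivity
  set b := bulkRate r n p t
  rw [div_le_div_iff₀ (by positivity) (by positivity), one_mul, mul_add, mul_one]
  refine add_le_add_right ?_ v
  rw [le_div_iff₀ hΛ0] at hb
  calc v * (meanConst r / varConst r * b)
      ≤ (varConst r / meanConst r * Λ) * (meanConst r / varConst r * b) := by gcongr
    _ = b * Λ := by field_simp
    _ ≤ t ^ 2 := hb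

/-- The upper tail of the star sum, for all values of the parameters. -/
theorem exists_measureReal_le_exp (r : ℕ) (hr : 2 ≤ r) : ∃ c : ℝ, 0 < c ∧
    ∀ (n : ℕ) (p : unitInterval) (t : ℝ) (Ω : Type u) [MeasurableSpace Ω] (P : Measure Ω)
      (Y : Fin n → Ω → ℕ), r ≤ n → 0 < (p : ℝ) → 0 < t → IsBinomialSample P n p Y →
    P.real {ω | n * chooseMean r n p + t ≤ starSum r Y ω} ≤
      Real.exp (-(c * min (bulkRate r n p t) (clusterRate r n p t))) := by
  obtain ⟨D₁, hD₁, H₁⟩ := measureReal_le_of_sparse.{u} r hr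
  obtain ⟨D₂, hD₂, H₂⟩ := measureReal_le_of_dense.{u} r hr
  obtain ⟨D₃, hD₃, H₃⟩ := measureReal_le_of_intermediate.{u} r hr
  have hκ := meanConst_pos (show 1 ≤ r by omega)
  have hV := varConst_pos (show 1 ≤ r by omega)
  set c₀ : ℝ := 1 / (D₁ + D₂ + D₃) with hc₀
  set c₁ : ℝ := meanConst r / varConst r with hc₁
  have h₀ : 0 < c₀ := by positivity
  have h₁ : 0 < c₁ := by positivity
  refine ⟨min (c₀ / 2) (c₁ / (1 + c₁ * (8 / c₀))), by positivity,
    fun n p t Ω _ P Y hn h0 ht hY => ?_⟩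
  have hb := bulkRate_nonneg (r := r) (n := n) h0.le ht.le
  have hcl := clusterRate_nonneg (r := r) (n := n) h0 p.2.2 ht.le
  set Φ := min (bulkRate r n p t) (clusterRate r n p t) with hΦ
  have hΦ0 : 0 ≤ Φ := le_min hb hcl
  have hD : ∀ D, 0 < D → D ≤ D₁ + D₂ + D₃ →
      30 * Real.exp (-(1 / D * Φ)) ≤ 30 * Real.exp (-(c₀ * Φ)) := by
    intro D hD hle
    have : c₀ ≤ 1 / D := one_div_le_one_div_of_le hD hle
    gcongr
  refine le_exp_neg_mul_of_le_div hΦ0 h₀ h₁ ?_ ?_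
  · rcases le_total (n * (n * (p : ℝ)) ^ (2 * r)) 1 with h | h
    · exact (H₁ n p t Ω P Y hn h0 ht hY h).trans (hD D₁ hD₁ (by linarith))
    rcases le_total (Real.log n) (n * (p : ℝ)) with h' | h'
    · exact (H₂ n p t Ω P Y hn h0 ht hY h').trans (hD D₂ hD₂ (by linarith))
    · exact (H₃ n p t Ω P Y hn h0 ht hY h h').trans (hD D₃ hD₃ (by linarith))
  · refine (hY.measureReal_le_div_one_add (by omega) hn h0 ht).trans ?_
    refine one_div_le_one_div_of_le (by positivity) ?_
    have := mul_le_mul_of_nonneg_left (min_le_left (bulkRate r n p t) (clusterRate r n p t)) h₁.le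
    linarith

end IsBinomialSample

/-! ### Comparison of the rates in the regimes of the assertions -/

section Comparison

variable {r n : ℕ} {p t : ℝ}

theorem clusterSize_mono {s : ℝ} (hs : 0 ≤ s) (hst : s ≤ t) :
    clusterSize r n s ≤ clusterSize r n t := by
  unfold clusterSize
  exact max_le_max (Real.rpow_le_rpow hs hst (by positivity))
    (div_le_div_of_nonneg_right hst (by positivity))

theorem mul_clusterSize_le (hr : 1 ≤ r) {δ : ℝ} (hδ : 0 < δ) (hδ1 : δ ≤ 1) (ht : 0 ≤ t) :
    δ * clusterSize r n t ≤ clusterSize r n (δ * t) := by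
  unfold clusterSize
  rw [mul_max_of_nonneg _ _ hδ.le]
  refine max_le_max ?_ (by rw [mul_div_assoc])
  rw [Real.mul_rpow hδ.le ht]
  refine mul_le_mul_of_nonneg_right ?_ (Real.rpow_nonneg ht _)
  have hr0 : (1 : ℝ) ≤ r := by exact_mod_cast hr
  calc δ = δ ^ (1 : ℝ) := (Real.rpow_one δ).symm
    _ ≤ δ ^ (1 / (r : ℝ)) := Real.rpow_le_rpow_of_exponent_ge hδ hδ1
        ((div_le_one (by linarith)).2 hr0)

/-- Beyond the mean the Chernoff rate is at least linear, so the bulk rate is at least of order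
t/(np)^(r-1); the cluster rate is at most of that order. -/
theorem clusterRate_le_bulkRate (hr : 2 ≤ r) (hn : r ≤ n) (h0 : 0 < p) (h1 : p ≤ 1)
    (ha : 1 / 2 ≤ n * p) (ht : n * chooseMean r n p ≤ t) :
    meanConst r / (12 * 2 ^ r) * clusterRate r n p t ≤ bulkRate r n p t := by
  have hn0 : (0 : ℝ) < n := by exact_mod_cast (by omega : 0 < n)
  have hm := chooseMean_pos hn h0
  have hκ := meanConst_pos (show 1 ≤ r by omega)
  have hmκ := meanConst_mul_pow_le (show 1 ≤ r by omega) hn h0.le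
  have ha0 : 0 < n * p := by positivity
  have hμ : 0 < n * chooseMean r n p := by positivity
  have h2 := clusterRate_le_div hr (by omega) h0 h1 ha hκ (meanConst_le_one (by omega))
    (le_trans (by nlinarith) ht)
  have h3 := div_le_bulkRate h0.le hμ ht
  have h4 : 1 + (n * p) ^ (r - 1) ≤ 2 ^ r * (n * p) ^ (r - 1) := by
    have h5 : 1 ≤ 2 ^ (r - 1) * (n * p) ^ (r - 1) := by
      rw [← mul_pow]; exact one_le_pow₀ (by linarith)
    have h6 : (n * p) ^ (r - 1) ≤ 2 ^ (r - 1) * (n * p) ^ (r - 1) :=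
      le_mul_of_one_le_left (by positivity) (one_le_pow₀ (by norm_num))
    have e : (2 : ℝ) ^ r = 2 * 2 ^ (r - 1) := by rw [← pow_succ']; congr 1; omega
    rw [e]; linarith
  have ht0 : 0 < t := hμ.trans_le ht
  have h5 : t / (2 ^ r * (n * p) ^ (r - 1)) ≤ t / (1 + (n * p) ^ (r - 1)) :=
    div_le_div_of_nonneg_left ht0.le (by positivity) h4
  calc meanConst r / (12 * 2 ^ r) * clusterRate r n p t
      ≤ meanConst r / (12 * 2 ^ r) * (4 / meanConst r * (t / (n * p) ^ (r - 1))) := by gcongr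
    _ = t / (2 ^ r * (n * p) ^ (r - 1)) / 3 := by field_simp; norm_num
    _ ≤ bulkRate r n p t := by linarith

/-- The constant in the lower bound for the variance of `Y.choose r`. -/
noncomputable def varLowerConst (r : ℕ) (ξ : ℝ) : ℝ := min (1 / 4) (ξ * meanConst r / 2)

theorem varLowerConst_pos (hr : 1 ≤ r) {ξ : ℝ} (hξ : 0 < ξ) : 0 < varLowerConst r ξ := by
  have := meanConst_pos hr
  unfold varLowerConst
  positivity

theorem varLowerConst_le (r : ℕ) (ξ : ℝ) : varLowerConst r ξ ≤ 1 / 4 := min_le_left _ _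

theorem sq_div_var_le (hr : 2 ≤ r) (hn : r ≤ n) (h0 : 0 < p) {ξ : ℝ} (hξ : 0 < ξ)
    (hp : p ≤ 1 - ξ) {x : ℝ} (hx : 0 ≤ x) :
    varLowerConst r ξ * (x / (n * chooseVar r n p)) ≤
      x / (n * chooseMean r n p * (1 + (n * p) ^ (r - 1))) := by
  have hn0 : (0 : ℝ) < n := by exact_mod_cast (by omega : 0 < n)
  have hm := chooseMean_pos hn h0
  have hv := mean_le_chooseVar hr hn h0 hξ hp
  have hc := varLowerConst_pos (r := r) (by omega) hξ
  rw [← varLowerConst] at hv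
  have hΛ : 0 < chooseMean r n p * (1 + (n * p) ^ (r - 1)) := by positivity
  have hv0 : 0 < chooseVar r n p := lt_of_lt_of_le (by positivity) hv
  rw [← mul_div_assoc, div_le_div_iff₀ (by positivity) (by positivity)]
  calc _ = x * n * (varLowerConst r ξ * (chooseMean r n p * (1 + (n * p) ^ (r - 1)))) := by ring
    _ ≤ x * n * chooseVar r n p := by gcongr
    _ = _ := by ring

theorem le_of_pos_mul_chooseMean {c : ℝ} (h : 0 < c * chooseMean r n p) : r ≤ n := by
  by_contra hcon
  simp [chooseMean, Nat.choose_eq_zero_of_lt (not_le.1 hcon)] at h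

theorem le_of_pos_of_le_starSumMax {x : ℝ} (hx : 0 < x) (h : x ≤ starSumMax r n) : r ≤ n := by
  by_contra hcon
  simp only [starSumMax, Nat.choose_eq_zero_of_lt (not_le.1 hcon), Nat.cast_zero, mul_zero] at h
  linarith

/-- The cluster rate is at most linear for sparse samples when the deviation exceeds the
standard deviation by a power of the logarithm. -/
theorem clusterRate_le_mul (hr : 2 ≤ r) (hn : r ≤ n) (h0 : 0 < p) {ξ δ : ℝ} (hξ : 0 < ξ)
    (hξ1 : ξ ≤ 1) (hμ : ξ ≤ n * chooseMean r n p) (ht : 0 < t) (hδ : 0 < δ) (hδ1 : δ ≤ 1)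
    (h : δ * Real.log n ^ (2 * r) * t ^ (1 / (r : ℝ)) ≤ t ^ 2) :
    clusterRate r n p t ≤ (4 - 2 * Real.log ξ) * 4 ^ r / δ * t := by
  have hn2 : 2 ≤ n := hr.trans hn
  have hn0 : (1 : ℝ) ≤ n := by exact_mod_cast (by omega : 1 ≤ n)
  have hr0 : (2 : ℝ) ≤ r := by exact_mod_cast hr
  have hlog := half_le_log hn2
  have hlξ : Real.log ξ ≤ 0 := Real.log_nonpos hξ.le hξ1
  -- The mean is at most n^(r+1) p^r, so its lower bound keeps p above a power of n, up to a
  -- constant.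
  have hlp : Real.log (Real.exp 1 / p) ≤ (4 - 2 * Real.log ξ) * Real.log n := by
    have h1 : ξ ≤ n ^ (r + 1) * p ^ r := by
      refine hμ.trans ?_
      have : ((n.choose r : ℕ) : ℝ) ≤ (n : ℝ) ^ r := by exact_mod_cast Nat.choose_le_pow n r
      unfold chooseMean
      rw [pow_succ', mul_assoc]
      gcongr
    have h2 := Real.log_le_log hξ h1
    rw [Real.log_mul (by positivity) (by positivity), Real.log_pow, Real.log_pow] at h2
    push_cast at h2
    rw [log_exp_one_div h0]
    have h3 : r * (-Real.log p) ≤ r * (2 * Real.log n - Real.log ξ) := by nlinarith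
    have h4 := le_of_mul_le_mul_left h3 (by linarith)
    nlinarith
  obtain ⟨hx0, hxr⟩ := rpow_inv_natCast_spec (show 1 ≤ r by omega) ht
  have hC : 0 ≤ 4 - 2 * Real.log ξ := by linarith
  set δ' : ℝ := δ / 4 ^ r with hδ'
  have hδ'0 : 0 < δ' := by positivity
  have hδ'1 : δ' ≤ 1 := by
    rw [hδ', div_le_one (by positivity)]
    exact hδ1.trans (one_le_pow₀ (by norm_num))
  have hM : clusterSize r n t * Real.log n ≤ t / δ' := by
    unfold clusterSize
    set x := t ^ (1 / (r : ℝ)) with hx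
    rw [max_mul_of_nonneg _ _ (by linarith)]
    refine max_le ?_ ?_
    -- Doubling the logarithm ensures y ≥ 1, and the 4^r in δ' compensates. For x ≥ 1 the bound on
    -- x^(2r-1) is then compared through cubes, as 3(r-1) ≥ 2r-1 and 3 ≤ 2r.
    · set y := 2 * Real.log n with hy
      have hy1 : 1 ≤ y := by linarith
      have h1 : δ' * y ^ (2 * r) ≤ x ^ (2 * r - 1) := by
        have e : δ' * y ^ (2 * r) = δ * Real.log n ^ (2 * r) := by
          rw [hy, mul_pow, hδ', pow_mul (2 : ℝ)]; norm_num
          field_simp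
        have e2 : t ^ 2 = x ^ (2 * r - 1) * x := by
          rw [← hxr, ← pow_mul, ← pow_succ]; congr 1; omega
        rw [e2] at h
        rw [e]
        exact le_of_mul_le_mul_right h hx0
      have h2 : δ' * y ≤ x ^ (r - 1) := by
        rcases le_total x 1 with hx1 | hx1
        · have h3 : x ^ (2 * r - 1) ≤ x ^ (r - 1) := pow_le_pow_of_le_one hx0.le hx1 (by omega)
          have h4 : δ' * y ≤ δ' * y ^ (2 * r) :=
            mul_le_mul_of_nonneg_left (le_self_pow₀ hy1 (by omega)) hδ'0.le
          linarith
        · refine le_of_pow_le_pow_left₀ (n := 3) (by norm_num) (by positivity) ?_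
          have h3 : x ^ (2 * r - 1) ≤ (x ^ (r - 1)) ^ 3 := by
            rw [← pow_mul]; exact pow_le_pow_right₀ hx1 (by omega)
          have h4 : (δ' * y) ^ 3 ≤ δ' * y ^ (2 * r) := by
            rw [mul_pow]
            exact mul_le_mul (pow_le_of_le_one hδ'0.le hδ'1 (by norm_num))
              (pow_le_pow_right₀ hy1 (by omega)) (by positivity) hδ'0.le
          linarith
      rw [le_div_iff₀ hδ'0]
      calc x * Real.log n * δ' ≤ x * (δ' * y) := by rw [hy]; nlinarith [mul_pos hx0 hδ'0]
        _ ≤ x * x ^ (r - 1) := by gcongr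
        _ = t := by rw [← hxr, ← pow_succ']; congr 1; omega
    · have h1 : Real.log n ≤ (n : ℝ) ^ (r - 1) :=
        ((Real.log_le_sub_one_of_pos (by linarith)).trans (by linarith)).trans
          (le_self_pow₀ hn0 (by omega))
      have h2 : t / (n : ℝ) ^ (r - 1) * Real.log n ≤ t := by
        rw [div_mul_eq_mul_div, div_le_iff₀ (by positivity)]
        gcongr
      exact h2.trans (by rw [le_div_iff₀ hδ'0]; nlinarith)
  have hM0 := clusterSize_nonneg (r := r) (n := n) ht.le
  unfold clusterRate
  calc _ ≤ clusterSize r n t * ((4 - 2 * Real.log ξ) * Real.log n) := by gcongr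
    _ = (4 - 2 * Real.log ξ) * (clusterSize r n t * Real.log n) := by ring
    _ ≤ (4 - 2 * Real.log ξ) * (t / δ') := by gcongr
    _ = _ := by rw [hδ']; field_simp

end Comparison

/-! ### Specialised upper tails -/

namespace IsBinomialSample

theorem measureReal_eq_zero_of_lt {Ω : Type u} [MeasurableSpace Ω] {P : Measure Ω} {n : ℕ}
    {p : unitInterval} {Y : Fin n → Ω → ℕ} (hY : IsBinomialSample P n p Y) {r : ℕ}
    (hn : n < r) {t : ℝ} (ht : 0 < t) :
    P.real {ω | t ≤ starSum r Y ω} = 0 := by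
  have := hY.isProbabilityMeasure
  refine le_antisymm ?_ measureReal_nonneg
  have h1 := hY.measureReal_exists_le r
  rw [Nat.choose_eq_zero_of_lt hn, Nat.cast_zero, zero_mul, mul_zero] at h1
  refine (measureReal_mono ?_).trans h1
  intro ω (hω : t ≤ starSum r Y ω)
  by_contra hcon
  have hcon : ∀ i, Y i ω < r := by simpa using hcon
  have : starSum r Y ω = 0 :=
    Finset.sum_eq_zero fun i _ => by rw [Nat.choose_eq_zero_of_lt (hcon i), Nat.cast_zero]
  linarith

/-- The upper tail for deviations proportional to the mean. -/
theorem exists_measureReal_le_exp_of_proportional (r : ℕ) (hr : 2 ≤ r) (ε : ℝ) (hε : 0 < ε) :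
    ∃ c : ℝ, 0 < c ∧
      ∀ (n : ℕ) (p : unitInterval) (Ω : Type u) [MeasurableSpace Ω] (P : Measure Ω)
        (Y : Fin n → Ω → ℕ), r ≤ n → 0 < (p : ℝ) → IsBinomialSample P n p Y →
      P.real {ω | n * chooseMean r n p + ε * (n * chooseMean r n p) ≤ starSum r Y ω} ≤
        Real.exp (-(c * min (n * chooseMean r n p)
          (clusterSize r n (n * chooseMean r n p) * Real.log (1 / (p : ℝ))))) := by
  obtain ⟨c, hc, H⟩ := exists_measureReal_le_exp.{u} r hr
  have hκ := meanConst_pos (show 1 ≤ r by omega)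
  set δ : ℝ := min 1 ε with hδ
  have hδ0 : 0 < δ := lt_min one_pos hε
  have hδ1 : δ ≤ 1 := min_le_left _ _
  set f : ℝ := ε ^ 2 / (ε + 2) with hf
  have hf0 : 0 < f := by positivity
  have hfφ : f ≤ chernoffRate ε := sq_div_le_chernoffRate hε.le
  set c' : ℝ := min δ (f * meanConst r / 8) with hc'
  have hc'0 : 0 < c' := by positivity
  refine ⟨c * c', by positivity, fun n p Ω _ P Y hn h0 hY => ?_⟩
  have hn0 : (0 : ℝ) < n := by exact_mod_cast (by omega : 0 < n)
  have hm := chooseMean_pos hn h0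
  have hmκ := meanConst_mul_pow_le (show 1 ≤ r by omega) hn h0.le
  have hμ : 0 < n * chooseMean r n p := by positivity
  have ha0 : 0 < n * (p : ℝ) := by positivity
  refine le_exp_neg_mul_of_le hc.le (H n p _ Ω P Y hn h0 (by positivity) hY) ?_
  have hlog0 : 0 ≤ Real.log (1 / (p : ℝ)) := Real.log_nonneg (one_le_one_div h0 p.2.2)
  have hlog1 : Real.log (1 / (p : ℝ)) ≤ Real.log (Real.exp 1 / p) := by
    rw [log_exp_one_div h0, one_div, Real.log_inv]; linarith
  have hmul := mul_le_mul_of_nonneg_left hmκ hn0.le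
  have hbulk := bulkRate_eq (t := ε * (n * chooseMean r n p)) hμ
  rw [mul_div_cancel_right₀ _ hμ.ne'] at hbulk
  set μ := n * chooseMean r n p
  have hM := clusterSize_nonneg (r := r) (n := n) hμ.le
  have hΦ0 : 0 ≤ min μ (clusterSize r n μ * Real.log (1 / (p : ℝ))) :=
    le_min hμ.le (by positivity)
  have hfb : f * μ / (1 + (n * (p : ℝ)) ^ (r - 1)) ≤ bulkRate r n p (ε * μ) := by
    rw [hbulk]; gcongr
  refine le_min ?_ ?_
  · refine (mul_le_mul_of_nonneg_right (min_le_right _ _) hΦ0).trans (le_trans ?_ hfb)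
    -- The bulk rate is at least of order μ/(1 + (np)^(r-1)). For np ≤ 1 this has order μ; for np ≥
    -- 1 the cluster rate at μ is at most of this order.
    rcases le_total (n * (p : ℝ)) 1 with h | h
    · have h1 : (n * (p : ℝ)) ^ (r - 1) ≤ 1 := pow_le_one₀ ha0.le h
      have h2 : f * μ / 2 ≤ f * μ / (1 + (n * (p : ℝ)) ^ (r - 1)) :=
        div_le_div_of_nonneg_left (by positivity) (by positivity) (by linarith)
      refine le_trans ?_ h2
      calc f * meanConst r / 8 * min μ (clusterSize r n μ * Real.log (1 / (p : ℝ)))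
          ≤ f * 1 / 8 * μ := by
            gcongr
            · exact meanConst_le_one (by omega)
            · exact min_le_left _ _
        _ ≤ f * μ / 2 := by linarith [mul_pos hf0 hμ]
    · have h1 : 1 ≤ (n * (p : ℝ)) ^ (r - 1) := one_le_pow₀ h
      have h2 : f * μ / (2 * (n * (p : ℝ)) ^ (r - 1)) ≤ f * μ / (1 + (n * (p : ℝ)) ^ (r - 1)) :=
        div_le_div_of_nonneg_left (by positivity) (by positivity) (by linarith)
      refine le_trans ?_ h2
      have h3 := clusterRate_le_div (n := n) (t := μ) hr (by omega) h0 p.2.2 (by linarith) hκ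
        (meanConst_le_one (by omega)) (by linarith)
      calc f * meanConst r / 8 * min μ (clusterSize r n μ * Real.log (1 / (p : ℝ)))
          ≤ f * meanConst r / 8 * (4 / meanConst r * (μ / (n * (p : ℝ)) ^ (r - 1))) := by
            refine mul_le_mul_of_nonneg_left (((min_le_right _ _).trans ?_).trans h3)
              (by positivity)
            exact mul_le_mul_of_nonneg_left hlog1 hM
        _ = f * μ / (2 * (n * (p : ℝ)) ^ (r - 1)) := by field_simp; norm_num
  · refine (mul_le_mul_of_nonneg_right (min_le_left _ _) hΦ0).trans ?_
    have h2 : δ * clusterSize r n μ ≤ clusterSize r n (ε * μ) :=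
      (mul_clusterSize_le (by omega) hδ0 hδ1 hμ.le).trans
        (clusterSize_mono (by positivity) (mul_le_mul_of_nonneg_right (min_le_right _ _) hμ.le))
    unfold clusterRate
    calc δ * min μ (clusterSize r n μ * Real.log (1 / (p : ℝ)))
        ≤ δ * (clusterSize r n μ * Real.log (1 / (p : ℝ))) := by gcongr; exact min_le_right _ _
      _ = δ * clusterSize r n μ * Real.log (1 / (p : ℝ)) := by ring
      _ ≤ _ := mul_le_mul h2 hlog1 hlog0 (clusterSize_nonneg (by positivity))

/-- The upper tail, with the variance in place of its order of magnitude, when `n * p ≥ 1 / 2`. -/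
theorem exists_measureReal_le_exp_of_dense (r : ℕ) (hr : 2 ≤ r) (ξ : ℝ) (hξ : 0 < ξ) :
    ∃ c : ℝ, 0 < c ∧
      ∀ (n : ℕ) (p : unitInterval) (t : ℝ) (Ω : Type u) [MeasurableSpace Ω] (P : Measure Ω)
        (Y : Fin n → Ω → ℕ), r ≤ n → 0 < (p : ℝ) → (p : ℝ) ≤ 1 - ξ → 0 < t →
        IsBinomialSample P n p Y → 1 / 2 ≤ n * (p : ℝ) →
      P.real {ω | n * chooseMean r n p + t ≤ starSum r Y ω} ≤
        Real.exp (-(c * min (t ^ 2 / (n * chooseVar r n p)) (clusterRate r n p t))) := by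
  obtain ⟨c, hc, H⟩ := exists_measureReal_le_exp.{u} r hr
  have hκ := meanConst_pos (show 1 ≤ r by omega)
  have hv := varLowerConst_pos (r := r) (by omega) hξ
  have hv4 := varLowerConst_le r ξ
  set c' : ℝ := min (varLowerConst r ξ / 3) (meanConst r / (12 * 2 ^ r)) with hc'
  have hc'0 : 0 < c' := by positivity
  refine ⟨c * c', by positivity, fun n p t Ω _ P Y hn h0 hp ht hY ha => ?_⟩
  have hn0 : (0 : ℝ) < n := by exact_mod_cast (by omega : 0 < n)
  have hm := chooseMean_pos hn h0
  have hμ : 0 < n * chooseMean r n p := by positivity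
  refine le_exp_neg_mul_of_le hc.le (H n p _ Ω P Y hn h0 ht hY) ?_
  have hcl := clusterRate_nonneg (r := r) (n := n) h0 p.2.2 ht.le
  have hvar : 0 ≤ chooseVar r n p :=
    le_trans (by positivity) (mean_le_chooseVar hr hn h0 hξ hp)
  have hΦ0 : 0 ≤ min (t ^ 2 / (n * chooseVar r n p)) (clusterRate r n p t) :=
    le_min (by positivity) hcl
  refine le_min ?_ ?_
  · rcases le_total t (n * chooseMean r n p) with h | h
    · have h1 := sq_div_le_bulkRate h0.le hμ ht.le h
      have h2 := sq_div_var_le hr hn h0 hξ hp (sq_nonneg t)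
      refine (mul_le_mul (min_le_left _ _) (min_le_left _ _) hΦ0 (by positivity)).trans ?_
      linarith
    · refine (mul_le_mul (min_le_right _ _) (min_le_right _ _) hΦ0 (by positivity)).trans ?_
      exact clusterRate_le_bulkRate hr hn h0 p.2.2 ha h
  · have hc1 : c' ≤ 1 := (min_le_left _ _).trans (by linarith)
    exact (mul_le_of_le_one_left hΦ0 hc1).trans (min_le_right _ _)

/-- The upper tail in the regime where large values of the sample dominate. -/
theorem exists_measureReal_le_exp_of_cluster (r : ℕ) (hr : 2 ≤ r) (ξ : ℝ) (hξ : 0 < ξ)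
    (hξ1 : ξ ≤ 1) :
    ∃ c : ℝ, 0 < c ∧
      ∀ (n : ℕ) (p : unitInterval) (t : ℝ) (Ω : Type u) [MeasurableSpace Ω] (P : Measure Ω)
        (Y : Fin n → Ω → ℕ), r ≤ n → 0 < (p : ℝ) → (p : ℝ) ≤ 1 - ξ → 0 < t →
        IsBinomialSample P n p Y → ξ ≤ n * chooseMean r n p →
        clusterRate r n p t * Real.log n ^ (2 * r) ≤ t ^ 2 / (n * chooseVar r n p) →
      P.real {ω | n * chooseMean r n p + t ≤ starSum r Y ω} ≤
        Real.exp (-(c * clusterRate r n p t)) := by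
  obtain ⟨c, hc, H⟩ := exists_measureReal_le_exp.{u} r hr
  have hκ := meanConst_pos (show 1 ≤ r by omega)
  have hv := varLowerConst_pos (r := r) (by omega) hξ
  have hv4 := varLowerConst_le r ξ
  set v := varLowerConst r ξ
  have hlξ : Real.log ξ ≤ 0 := Real.log_nonpos hξ.le hξ1
  set B : ℝ := (4 - 2 * Real.log ξ) * 4 ^ r / (v * ξ) with hB
  have hB0 : 0 < B := by
    have : 0 < 4 - 2 * Real.log ξ := by linarith
    positivity
  set c' : ℝ := min 1 (min (v * (1 / 4) ^ r / 3) (min (meanConst r / (12 * 2 ^ r)) (1 / (6 * B))))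
    with hc'
  have hc'0 : 0 < c' := by positivity
  have hc1 : c' ≤ 1 := min_le_left _ _
  have hc2 : c' ≤ v * (1 / 4) ^ r / 3 := (min_le_right _ _).trans (min_le_left _ _)
  have hc3 : c' ≤ meanConst r / (12 * 2 ^ r) :=
    (min_le_right _ _).trans ((min_le_right _ _).trans (min_le_left _ _))
  have hc4 : c' ≤ 1 / (6 * B) :=
    (min_le_right _ _).trans ((min_le_right _ _).trans (min_le_right _ _))
  refine ⟨c * c', by positivity, fun n p t Ω _ P Y hn h0 hp ht hY hξμ hL => ?_⟩
  have hn0 : (0 : ℝ) < n := by exact_mod_cast (by omega : 0 < n)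
  have hm := chooseMean_pos hn h0
  have hμ : 0 < n * chooseMean r n p := by positivity
  have ha0 : 0 < n * (p : ℝ) := by positivity
  have hlog := half_le_log (hr.trans hn)
  refine le_exp_neg_mul_of_le hc.le (H n p _ Ω P Y hn h0 ht hY) ?_
  have hcl := clusterRate_nonneg (r := r) (n := n) h0 p.2.2 ht.le
  have h2 := sq_div_var_le hr hn h0 hξ hp (sq_nonneg t)
  have h3 : v * (clusterRate r n p t * Real.log n ^ (2 * r)) ≤
      t ^ 2 / (n * chooseMean r n p * (1 + (n * (p : ℝ)) ^ (r - 1))) :=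
    (mul_le_mul_of_nonneg_left hL hv.le).trans h2
  refine le_min ?_ (mul_le_of_le_one_left hcl hc1)
  -- In every case the bulk rate dominates a multiple of the cluster rate: for t ≤ μ by `hL`, as log
  -- n ≥ 1/2; for t ≥ μ and np ≥ 1/2 by the general comparison; for t ≥ μ and np ≤ 1/2 because the
  -- bulk rate is at least t/6 and `hL` makes the cluster rate at most linear in t.
  rcases le_total t (n * chooseMean r n p) with h | h
  · have h1 := sq_div_le_bulkRate h0.le hμ ht.le h
    have h4 : (1 / 4 : ℝ) ^ r ≤ Real.log n ^ (2 * r) := by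
      rw [pow_mul]
      exact pow_le_pow_left₀ (by norm_num) (by nlinarith) r
    have h5 : v * (clusterRate r n p t * (1 / 4) ^ r) ≤
        v * (clusterRate r n p t * Real.log n ^ (2 * r)) := by gcongr
    refine (mul_le_mul_of_nonneg_right hc2 hcl).trans ?_
    linarith
  rcases le_total (1 / 2) (n * (p : ℝ)) with ha | ha
  · exact (mul_le_mul_of_nonneg_right hc3 hcl).trans
      (clusterRate_le_bulkRate hr hn h0 p.2.2 ha h)
  · have h4 := div_le_bulkRate h0.le hμ h
    have h5 : (n * (p : ℝ)) ^ (r - 1) ≤ 1 := pow_le_one₀ ha0.le (by linarith)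
    have h6 : t / 2 ≤ t / (1 + (n * (p : ℝ)) ^ (r - 1)) :=
      div_le_div_of_nonneg_left ht.le (by positivity) (by linarith)
    have h7 : v * ξ * Real.log n ^ (2 * r) * t ^ (1 / (r : ℝ)) ≤ t ^ 2 := by
      have hx0 := Real.rpow_pos_of_pos ht (1 / (r : ℝ))
      have hL1 := one_le_log_exp_one_div h0 p.2.2
      have h8 : t ^ (1 / (r : ℝ)) ≤ clusterRate r n p t := by
        unfold clusterRate
        calc t ^ (1 / (r : ℝ)) = t ^ (1 / (r : ℝ)) * 1 := (mul_one _).symm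
          _ ≤ _ := mul_le_mul (le_max_left _ _) hL1 zero_le_one (clusterSize_nonneg ht.le)
      rw [le_div_iff₀ (by positivity)] at h3
      have h9 : ξ ≤ n * chooseMean r n p * (1 + (n * (p : ℝ)) ^ (r - 1)) := by
        refine hξμ.trans (le_mul_of_one_le_right hμ.le ?_)
        have : 0 ≤ (n * (p : ℝ)) ^ (r - 1) := by positivity
        linarith
      calc v * ξ * Real.log n ^ (2 * r) * t ^ (1 / (r : ℝ))
          = v * (t ^ (1 / (r : ℝ)) * Real.log n ^ (2 * r)) * ξ := by ring
        _ ≤ v * (clusterRate r n p t * Real.log n ^ (2 * r)) *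
            (n * chooseMean r n p * (1 + (n * (p : ℝ)) ^ (r - 1))) := by gcongr
        _ ≤ t ^ 2 := h3
    have h8 := clusterRate_le_mul hr hn h0 hξ hξ1 hξμ ht (by positivity : 0 < v * ξ)
      (by nlinarith) h7
    rw [← hB] at h8
    calc c' * clusterRate r n p t ≤ 1 / (6 * B) * (B * t) := by gcongr
      _ = t / 6 := by field_simp
      _ ≤ bulkRate r n p t := by linarith

end IsBinomialSample

/-! ### The four assertions -/

theorem theorem5 (r : ℕ) (hr : 2 ≤ r) :
    -- upper bound for constant `ε`; the constant `c` depends on `r` and `ε` only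
    (∀ ε : ℝ, 0 < ε → ∃ c : ℝ, 0 < c ∧
      ∀ (n : ℕ) (p : unitInterval) (Ω : Type u) [MeasurableSpace Ω] (P : Measure Ω)
        (Y : Fin n → Ω → ℕ), 1 ≤ n → 0 < (p : ℝ) → IsBinomialSample P n p Y →
      let μ : ℝ := ∫ ω, starSum r Y ω ∂P
      let Φ : ℝ := min μ (clusterSize r n μ * Real.log (1 / (p : ℝ)))
      1 ≤ (1 + ε) * μ → (1 + ε) * μ ≤ starSumMax r n →
      P.real {ω | (1 + ε) * μ ≤ starSum r Y ω} ≤ Real.exp (-(c * Φ))) ∧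
    -- upper bound for `ε ≥ n ^ (-α)`; `α` depends on `r` only, `c` on `r` and `ξ` only
    (∃ α : ℝ, 0 < α ∧ ∀ ξ : ℝ, 0 < ξ → ξ < 1 → ∃ c : ℝ, 0 < c ∧
      ∀ (n : ℕ) (p : unitInterval) (ε : ℝ) (Ω : Type u) [MeasurableSpace Ω] (P : Measure Ω)
        (Y : Fin n → Ω → ℕ), 1 ≤ n → 0 < (p : ℝ) → (p : ℝ) ≤ 1 - ξ → (n : ℝ) ^ (-α) ≤ ε →
        IsBinomialSample P n p Y →
      let μ : ℝ := ∫ ω, starSum r Y ω ∂P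
      let σ2 : ℝ := variance (starSum r Y) P
      let Φ : ℝ := min (chernoffRate ε * μ ^ 2 / σ2)
        (clusterSize r n (ε * μ) * Real.log (Real.exp 1 / (p : ℝ)))
      1 ≤ Φ → 1 ≤ (1 + ε) * μ → (1 + ε) * μ ≤ starSumMax r n →
      P.real {ω | (1 + ε) * μ ≤ starSum r Y ω} ≤ Real.exp (-(c * Φ))) ∧
    -- upper bounds for general deviations `t`; `c` depends on `r` and `ξ` only
    (∀ ξ : ℝ, 0 < ξ → ξ < 1 → ∃ c : ℝ, 0 < c ∧
      ∀ (n : ℕ) (p : unitInterval) (t : ℝ) (Ω : Type u) [MeasurableSpace Ω] (P : Measure Ω)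
        (Y : Fin n → Ω → ℕ), 1 ≤ n → 0 < (p : ℝ) → (p : ℝ) ≤ 1 - ξ →
        IsBinomialSample P n p Y →
      let μ : ℝ := ∫ ω, starSum r Y ω ∂P
      let σ2 : ℝ := variance (starSum r Y) P
      let L : ℝ := clusterSize r n t * Real.log (Real.exp 1 / (p : ℝ))
      1 ≤ μ + t → μ + t ≤ starSumMax r n →
      (Real.log n / n ≤ (p : ℝ) → Real.sqrt σ2 ≤ t →
        P.real {ω | μ + t ≤ starSum r Y ω} ≤ Real.exp (-(c * min (t ^ 2 / σ2) L))) ∧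
      (ξ ≤ μ → 0 < t → L * Real.log n ^ (2 * r) ≤ t ^ 2 / σ2 →
        P.real {ω | μ + t ≤ starSum r Y ω} ≤ Real.exp (-(c * L)))) ∧
    -- the technical upper bound; `c` depends on `r` and `γ` only
    (∀ γ : ℝ, 0 < γ → ∃ c : ℝ, 0 < c ∧
      ∀ (n : ℕ) (p : unitInterval) (t : ℝ) (Ω : Type u) [MeasurableSpace Ω] (P : Measure Ω)
        (Y : Fin n → Ω → ℕ), 1 ≤ n → 0 < (p : ℝ) → 0 < t → IsBinomialSample P n p Y →
      let μ : ℝ := ∫ ω, starSum r Y ω ∂P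
      let Λ : ℝ := μ * (1 + ((n : ℝ) * p) ^ (r - 1))
      let M : ℝ := clusterSize r n t
      let s : ℝ := Real.log (Real.exp 1 / (p : ℝ) ^ γ)
      ((n : ℝ) * p ∉ Set.Ioo ((n : ℝ) ^ (-γ)) (γ * Real.log n) ∨
        (if t ≤ min μ ((n : ℝ) ^ r) then
          γ * min (t ^ (1 / (r : ℝ)) * Real.log n ^ r) (M * s * Real.log n ^ (r - 1)) else 0)
          ≤ t ^ 2 / μ) →
      P.real {ω | μ + t ≤ starSum r Y ω} ≤
        (1 + 1 / (n : ℝ)) *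
          Real.exp (-(c * min (chernoffRate (t / μ) * μ ^ 2 / Λ)
            (M * Real.log (Real.exp 1 / (p : ℝ)))))) := by
  have hmean : ∀ {Ω : Type u} [MeasurableSpace Ω] {P : Measure Ω} {n : ℕ} {p : unitInterval}
      {Y : Fin n → Ω → ℕ}, IsBinomialSample P n p Y →
      ∫ ω, starSum r Y ω ∂P = n * chooseMean r n p := fun hY => hY.integral_starSum r
  have hvar : ∀ {Ω : Type u} [MeasurableSpace Ω] {P : Measure Ω} {n : ℕ} {p : unitInterval}
      {Y : Fin n → Ω → ℕ}, IsBinomialSample P n p Y →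
      variance (starSum r Y) P = n * chooseVar r n p := fun hY => hY.variance_starSum r
  have hchoose : ∀ {n : ℕ} {p c : ℝ}, 1 ≤ c * (n * chooseMean r n p) → r ≤ n := by
    intro n p c h
    rw [← mul_assoc] at h
    exact le_of_pos_mul_chooseMean (zero_lt_one.trans_le h)
  obtain ⟨c₀, hc₀, H₀⟩ := IsBinomialSample.exists_measureReal_le_exp.{u} r hr
  -- Any positive α would serve: the lower bound on ε enters only through ε > 0.
  refine ⟨fun ε hε => ?_, ⟨1, one_pos, fun ξ hξ hξ1 => ?_⟩, fun ξ hξ hξ1 => ?_, fun γ _ => ?_⟩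
  · obtain ⟨c, hc, H⟩ :=
      IsBinomialSample.exists_measureReal_le_exp_of_proportional.{u} r hr ε hε
    refine ⟨c, hc, fun n p Ω _ P Y _ h0 hY => ?_⟩
    simp only [hmean hY]
    intro h1 _
    have := H n p Ω P Y (hchoose h1) h0 hY
    rwa [← one_add_mul] at this
  · have hv := varLowerConst_pos (r := r) (by omega) hξ
    have hv4 := varLowerConst_le r ξ
    refine ⟨c₀ * varLowerConst r ξ, by positivity, fun n p ε Ω _ P Y hn h0 hp hε hY => ?_⟩
    simp only [hmean hY, hvar hY]
    intro _ h1 _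
    have hrn := hchoose h1
    have hn0 : (0 : ℝ) < n := by exact_mod_cast hn
    have hε0 : 0 < ε := lt_of_lt_of_le (Real.rpow_pos_of_pos hn0 _) hε
    have hμ : 0 < n * chooseMean r n p := mul_pos hn0 (chooseMean_pos hrn h0)
    have hcl := clusterRate_nonneg (r := r) (n := n) (t := ε * (n * chooseMean r n p)) h0 p.2.2
      (by positivity)
    have hφ := chernoffRate_nonneg hε0.le
    rw [one_add_mul]
    refine le_exp_neg_mul_of_le hc₀.le (H₀ n p _ Ω P Y hrn h0 (by positivity) hY) ?_
    refine le_min ?_ ?_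
    · refine (mul_le_mul_of_nonneg_left (min_le_left _ _) hv.le).trans ?_
      unfold bulkRate
      rw [mul_div_cancel_right₀ _ hμ.ne']
      exact sq_div_var_le hr hrn h0 hξ hp (by positivity)
    · refine (mul_le_mul_of_nonneg_left (min_le_right _ _) hv.le).trans ?_
      exact mul_le_of_le_one_left hcl (by linarith)
  · obtain ⟨c₁, hc₁, H₁⟩ := IsBinomialSample.exists_measureReal_le_exp_of_dense.{u} r hr ξ hξ
    obtain ⟨c₂, hc₂, H₂⟩ :=
      IsBinomialSample.exists_measureReal_le_exp_of_cluster.{u} r hr ξ hξ hξ1.le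
    refine ⟨min c₁ c₂, lt_min hc₁ hc₂, fun n p t Ω _ P Y hn h0 hp hY => ?_⟩
    simp only [hmean hY, hvar hY]
    intro h1 h2
    have hrn : r ≤ n := le_of_pos_of_le_starSumMax (zero_lt_one.trans_le h1) h2
    have hn0 : (0 : ℝ) < n := by exact_mod_cast hn
    have hv0 : 0 < n * chooseVar r n p := by
      have hm := chooseMean_pos hrn h0
      have hκ := meanConst_pos (show 1 ≤ r by omega)
      exact mul_pos hn0 (lt_of_lt_of_le (by positivity) (mean_le_chooseVar hr hrn h0 hξ hp))
    refine ⟨fun hlog ht => ?_, fun hμ ht hL => ?_⟩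
    · have ht0 : 0 < t := (Real.sqrt_pos.2 hv0).trans_le ht
      have ha : 1 / 2 ≤ n * (p : ℝ) := by
        rw [div_le_iff₀ hn0] at hlog
        linarith [half_le_log (hr.trans hrn)]
      refine (H₁ n p t Ω P Y hrn h0 hp ht0 hY ha).trans (Real.exp_le_exp.2 (neg_le_neg ?_))
      exact mul_le_mul_of_nonneg_right (min_le_left _ _)
        (le_min (by positivity) (clusterRate_nonneg h0 p.2.2 ht0.le))
    · refine (H₂ n p t Ω P Y hrn h0 hp ht hY hμ hL).trans (Real.exp_le_exp.2 (neg_le_neg ?_))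
      exact mul_le_mul_of_nonneg_right (min_le_right _ _) (clusterRate_nonneg h0 p.2.2 ht.le)
  · refine ⟨c₀, hc₀, fun n p t Ω _ P Y hn h0 ht hY => ?_⟩
    simp only [hmean hY]
    intro _
    rcases lt_or_ge n r with hrn | hrn
    · have hμ : n * chooseMean r n p = 0 := by
        simp [chooseMean, Nat.choose_eq_zero_of_lt hrn]
      rw [hμ, zero_add, hY.measureReal_eq_zero_of_lt hrn ht]
      positivity
    · refine (H₀ n p t Ω P Y hrn h0 ht hY).trans ?_
      refine le_mul_of_one_le_left (Real.exp_pos _).le ?_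
      have : 0 ≤ 1 / (n : ℝ) := by positivity
      linarith
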